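/- **Setting.** Let $n\ge 1$, let $G_1,\dots,G_n:\mathbb{R}^p\to\mathbb{R}^p$ be $\frac1{L_g}$-co-coercive, i.e. $\langle G_iu-G_iv,u-v\rangle\ge\frac1{L_g}\|G_iu-G_iv\|^2$ for all $u,v$, with $L_g>0$, and put $G:=\frac1n\sum_{i=1}^nG_i$. Let $T:\mathbb{R}^p\rightrightarrows\mathbb{R}^p$ be maximally $\nu$-co-hypomonotone with $\nu\ge0$, i.e. $\langle x-y,u-v\rangle\ge-\nu\|x-y\|^2$ whenever $x\in Tu$, $y\in Tv$, and the graph of $T$ is not properly contained in the graph of another operator with this property. Assume $L_g\nu<1$ and that $0\in Gu+Tu$ has a solution. Let $\lambda>0$ satisfy $$2\nu\le\lambda<\frac{2(1+\sqrt{1-L_g\nu})}{L_g},\qquad\text{and put}\qquad L:=\frac{4(1-L_g\nu)}{\lambda(4-L_g\lambda)-4\nu}.$$ Let $J_{\lambda T}x:=\{u: x\in u+\lambda Tu\}$ be the resolvent, and define $$\mathcal{G}_{i,\lambda}x:=G_i(J_{\lambda T}x)+\tfrac1\lambda(x-J_{\lambda T}x),\qquad \mathcal{G}_\lambda:=\tfrac1n\sum_{i=1}^n\mathcal{G}_{i,\lambda},\qquad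 \mathcal{F}_\lambda u:=\tfrac1\lambda\big(u-J_{\lambda T}(u-\lambda Gu)\big).$$ **Method.** Let $r>2$, $\theta_k:=\frac{k}{k+r+2}$, $\gamma_k:=\frac{k}{k+r}$, $\eta_k:=\frac{2\beta(k+r)}{k+r+2}$. From a deterministic $x^0=x^{-1}$, with $u^{-1}:=J_{\lambda T}x^{-1}$, let for $k\ge0$ $$u^k:=J_{\lambda T}x^k,\qquad \widetilde{\mathcal S}^k_\lambda:=\widetilde S_u^k+\tfrac1\lambda(x^k-u^k)-\tfrac{\gamma_k}\lambda(x^{k-1}-u^{k-1}),\qquad x^{k+1}:=x^k+\theta_k(x^k-x^{k-1})-\eta_k\widetilde{\mathcal S}^k_\lambda,$$ where $\widetilde S_u^k$ are random vectors on a probability space with a filtration $(\mathcal{F}_k)_{k\ge0}$ (all the randomness that determines $x^0,\dots,x^k$), $\widetilde S_u^0:=Gu^0$, and $\widetilde{\mathcal S}^k_\lambda$ is an unbiased variance-reduced estimator of $\mathcal{S}^k_\lambda:=\mathcal{G}_\lambda x^k-\gamma_k\mathcal{G}_\lambda x^{k-1}$ in the following sense: $\widetilde{\mathcal S}_\lambda^k$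 is $\mathcal{F}_{k+1}$-measurable, and there are $\rho\in(0,1)$, $\Theta>0$, $\hat\Theta\ge0$ and nonnegative integrable random variables $\Delta_k$ with $\Delta_0=0$ almost surely such that for all $k\ge1$ the error $\widetilde{\mathcal S}^k_\lambda-\mathcal{S}^k_\lambda$ is square integrable and, almost surely, with $U_k:=\frac1n\sum_{i=1}^n\|\mathcal{G}_{i,\lambda}x^k-\mathcal{G}_{i,\lambda}x^{k-1}\|^2$, $$\mathbb{E}[\widetilde{\mathcal S}^k_\lambda-\mathcal{S}^k_\lambda\mid\mathcal{F}_k]=0,\qquad \mathbb{E}[\|\widetilde{\mathcal S}^k_\lambda-\mathcal{S}^k_\lambda\|^2\mid\mathcal{F}_k]\le\mathbb{E}[\Delta_k\mid\mathcal{F}_k],$$ $$\frac{\mathbb{E}[\Delta_k\mid\mathcal{F}_k]}{(1-\gamma_k)^2}\le\frac{(1-\rho)\Delta_{k-1}}{(1-\gamma_{k-1})^2}+\frac{\Theta\,U_k}{(1-\gamma_k)^2}+\frac{\hat\Theta\,U_{k-1}}{(1-\gamma_{k-1})^2}.$$ Assume $0<\beta<\bar\beta:=\frac{\rho}{[\rho+(r+1)(\Theta+\hat\Theta)]L}$,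 and put $$\Lambda:=\tfrac{4\beta(\rho-[\rho+(r+1)(\Theta+\hat\Theta)]L\beta)}{L\rho(r+1)},\quad \psi:=\tfrac{4\beta^2(\Theta+\hat\Theta)}{\rho\Lambda},\quad C_0:=r(1+3r+8rL^2\beta^2),\quad C_1:=\tfrac{4r^2(r-1)L^2\beta^2}{r+2}+\big(\tfrac2r+\psi\big)C_0,$$ $$C_2:=4r^2L^2\beta^2+\Big[\psi+\tfrac{2(r+2)^2}{r}\Big]C_0+\tfrac{4(r+2)^2C_1}{r(r-2)},\qquad C_3:=\tfrac{(r+2)^2(C_1+C_2)}{2r^2}.$$ **Theorem.** The resolvent $J_{\lambda T}$ is single-valued and defined on all of $\mathbb{R}^p$, and the following hold, all expectations being finite. (a) For every $x^\star$ with $\mathcal{G}_\lambda x^\star=0$, for both $Q_k=\|x^{k+1}-x^k\|^2$ and $Q_k=\|u^{k+1}-u^k\|^2$, $$\sum_{k=0}^\infty(2k+r+3)\,\mathbb{E}[Q_k]\le C_0\|x^0-x^\star\|^2,\qquad \mathbb{E}[Q_k]\le\frac{C_2\|x^0-x^\star\|^2}{(k+r+2)^2}\quad(k\ge0).$$ (b)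 For every $x^\star$ with $\mathcal{G}_\lambda x^\star=0$, for both $Q_k=\|\mathcal{G}_\lambda x^k\|^2$ and $Q_k=\|\mathcal{F}_\lambda u^k\|^2$, $$\sum_{k=0}^\infty(2k+r+3)\,\mathbb{E}[Q_k]\le\frac{(r+2)^2}{2\beta^2r^2}\Big(C_0+\frac{2C_1}{r-2}\Big)\|x^0-x^\star\|^2,\qquad \mathbb{E}[Q_k]\le\frac{C_3\|x^0-x^\star\|^2}{\beta^2(k+r-1)(k+r+2)}\quad(k\ge0).$$ Moreover $O(1/\epsilon)$ iterations suffice for $\mathbb{E}[Q_k]\le\epsilon^2$: for every $\epsilon>0$ this holds for all $k\ge\frac{\sqrt{C_3}\,\|x^0-x^\star\|}{\beta\,\epsilon}$. (c) For each of the four sequences $Q_k=\|x^{k+1}-x^k\|^2$, $\|u^{k+1}-u^k\|^2$, $\|\mathcal{G}_\lambda x^k\|^2$, $\|\mathcal{F}_\lambda u^k\|^2$, one has $\lim_{k\to\infty}k^2\,\mathbb{E}[Q_k]=0$, and $\lim_{k\to\infty}k^2Q_k=0$ almost surely. (d) There is a random variable $x^\star$ with values in $\{x:\mathcal{G}_\lambda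 x=0\}$ such that, almost surely, $x^k\to x^\star$ and $u^k\to J_{\lambda T}x^\star$; here $J_{\lambda T}x^\star$ solves $0\in Gu+Tu$. -/

import Mathlib

open MeasureTheory Filter Topology

noncomputable section

namespace VFKM

/-- The Euclidean space `ℝ^p`. -/
abbrev Vec (p : ℕ) : Type := EuclideanSpace ℝ (Fin p)

/-! ### Operators -/

/-- The finite-sum operator `(1/n) ∑ i, G_i`. -/
def avg {n p : ℕ} (G : Fin n → Vec p → Vec p) (x : Vec p) : Vec p :=
  (1 / (n : ℝ)) • ∑ i, G i x

/-- `F` is `(1/L)`-co-coercive. -/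
def IsCocoercive {p : ℕ} (L : ℝ) (F : Vec p → Vec p) : Prop :=
  ∀ x y, (1 / L) * ‖F x - F y‖ ^ 2 ≤ inner ℝ (F x - F y) (x - y)

/-- The set-valued operator `T` is `ν`-co-hypomonotone. -/
def IsCohypomonotone {p : ℕ} (ν : ℝ) (T : Vec p → Set (Vec p)) : Prop :=
  ∀ u v x y, x ∈ T u → y ∈ T v → -ν * ‖x - y‖ ^ 2 ≤ inner ℝ (x - y) (u - v)

/-- The set-valued operator `T` is maximally `ν`-co-hypomonotone: its graph is not properly
contained in the graph of another `ν`-co-hypomonotone operator. -/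
def IsMaximallyCohypomonotone {p : ℕ} (ν : ℝ) (T : Vec p → Set (Vec p)) : Prop :=
  IsCohypomonotone ν T ∧
    ∀ T' : Vec p → Set (Vec p), IsCohypomonotone ν T' → (∀ u, T u ⊆ T' u) → T' = T

/-- The solution set of the inclusion `0 ∈ G u + T u`. -/
def zerSum {p : ℕ} (G : Vec p → Vec p) (T : Vec p → Set (Vec p)) : Set (Vec p) :=
  {u | ∃ z ∈ T u, G u + z = 0}

/-- The set-valued resolvent `{u | x ∈ u + lam T u}` of `lam T`. -/
def opResolventSet {p : ℕ} (T : Vec p → Set (Vec p)) (lam : ℝ) (x : Vec p) : Set (Vec p) :=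
  {u | ∃ z ∈ T u, u + lam • z = x}

/-- The resolvent `J_{lam T}` as a single-valued map (an element of `opResolventSet T lam x`,
whenever there is one). -/
def opResolvent {p : ℕ} (T : Vec p → Set (Vec p)) (lam : ℝ) (x : Vec p) : Vec p :=
  Classical.epsilon fun u => u ∈ opResolventSet T lam x

/-- The backward-forward splitting operators `𝒢_{i,lam}`. -/
def bfsComp {n p : ℕ} (G : Fin n → Vec p → Vec p) (T : Vec p → Set (Vec p)) (lam : ℝ)
    (i : Fin n) (x : Vec p) : Vec p :=
  G i (opResolvent T lam x) + (1 / lam) • (x - opResolvent T lam x)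

/-- The backward-forward splitting operator `𝒢_lam = (1/n) ∑ i, 𝒢_{i,lam}`. -/
def bfs {n p : ℕ} (G : Fin n → Vec p → Vec p) (T : Vec p → Set (Vec p)) (lam : ℝ) :
    Vec p → Vec p :=
  avg (bfsComp G T lam)

/-- The forward-backward splitting residual `(1/lam) (u - J_{lam T} (u - lam G u))`. -/
def fbsResidual {n p : ℕ} (G : Fin n → Vec p → Vec p) (T : Vec p → Set (Vec p)) (lam : ℝ)
    (u : Vec p) : Vec p :=
  (1 / lam) • (u - opResolvent T lam (u - lam • avg G u))

/-- The co-coercivity constant `L` of the backward-forward splitting operators. -/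
def bfsL (Lg ν lam : ℝ) : ℝ := 4 * (1 - Lg * ν) / (lam * (4 - Lg * lam) - 4 * ν)

/-! ### Parameters of the method -/

def thetaSeq (r : ℝ) (k : ℕ) : ℝ := k / (k + r + 2)

def gammaSeq (r : ℝ) (k : ℕ) : ℝ := k / (k + r)

def etaSeq (r β : ℝ) (k : ℕ) : ℝ := 2 * β * (k + r) / (k + r + 2)

/-! ### The constants -/

/-- The upper bound on `β`; here `Θs` is the sum of the two constants of the estimator. -/
def betaBar (L r ρ Θs : ℝ) : ℝ := ρ / ((ρ + (r + 1) * Θs) * L)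

def Lam (L r β ρ Θs : ℝ) : ℝ :=
  4 * β * (ρ - (ρ + (r + 1) * Θs) * L * β) / (L * ρ * (r + 1))

def psi (L r β ρ Θs : ℝ) : ℝ := 4 * β ^ 2 * Θs / (ρ * Lam L r β ρ Θs)

def C0 (L r β : ℝ) : ℝ := r * (1 + 3 * r + 8 * r * L ^ 2 * β ^ 2)

def C1 (L r β ρ Θs : ℝ) : ℝ :=
  4 * r ^ 2 * (r - 1) * L ^ 2 * β ^ 2 / (r + 2) + (2 / r + psi L r β ρ Θs) * C0 L r β

def C2 (L r β ρ Θs : ℝ) : ℝ :=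
  4 * r ^ 2 * L ^ 2 * β ^ 2 + (psi L r β ρ Θs + 2 * (r + 2) ^ 2 / r) * C0 L r β
    + 4 * (r + 2) ^ 2 * C1 L r β ρ Θs / (r * (r - 2))

def C3 (L r β ρ Θs : ℝ) : ℝ :=
  (r + 2) ^ 2 * (C1 L r β ρ Θs + C2 L r β ρ Θs) / (2 * r ^ 2)

/-! ### Estimators and the method

In all sequences below the index `-1` is identified with the index `0`, as in `x^{-1} := x^0`;
this is what the truncated subtraction `k - 1` on `ℕ` does. -/

section Stochastic

variable {Ω : Type*} {mΩ : MeasurableSpace Ω}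

/-- `S^k = G x^k - γ_k G x^{k-1}`. -/
def target {n p : ℕ} (G : Fin n → Vec p → Vec p) (γ : ℕ → ℝ) (x : ℕ → Ω → Vec p)
    (k : ℕ) (ω : Ω) : Vec p :=
  avg G (x k ω) - γ k • avg G (x (k - 1) ω)

/-- `U_k = (1/n) ∑ i, ‖G_i x^k - G_i x^{k-1}‖²`. -/
def variation {n p : ℕ} (G : Fin n → Vec p → Vec p) (x : ℕ → Ω → Vec p)
    (k : ℕ) (ω : Ω) : ℝ :=
  (1 / (n : ℝ)) * ∑ i, ‖G i (x k ω) - G i (x (k - 1) ω)‖ ^ 2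

/-- `S` is an unbiased variance-reduced estimator of `S^k = G x^k - γ_k G x^{k-1}`, with constants
`ρ`, `Θ`, `Θhat` and nonnegative random sequence `Δ`. The σ-algebra `ℱ k` holds the randomness that
determines `x^0, …, x^k`; the estimator `S k` is drawn at iteration `k`, after `x^k` is known and
before `x^{k+1}` is computed, hence it is known at time `k + 1`. -/
structure IsVREstimator {n p : ℕ} (P : Measure Ω) (ℱ : Filtration ℕ mΩ)
    (G : Fin n → Vec p → Vec p) (γ : ℕ → ℝ) (x S : ℕ → Ω → Vec p)
    (ρ Θ Θhat : ℝ) (Δ : ℕ → Ω → ℝ) : Prop where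
  rho_pos : 0 < ρ
  rho_le_one : ρ ≤ 1
  Theta_pos : 0 < Θ
  Thetahat_nonneg : 0 ≤ Θhat
  adapted : ∀ k, StronglyMeasurable[ℱ (k + 1)] (S k)
  Delta_nonneg : ∀ k, ∀ᵐ ω ∂P, 0 ≤ Δ k ω
  Delta_integrable : ∀ k, Integrable (Δ k) P
  error_memLp : ∀ k, 1 ≤ k → MemLp (fun ω => S k ω - target G γ x k ω) 2 P
  unbiased : ∀ k, 1 ≤ k →
    P[fun ω => S k ω - target G γ x k ω | ℱ k] =ᵐ[P] 0
  variance_le : ∀ k, 1 ≤ k →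
    P[fun ω => ‖S k ω - target G γ x k ω‖ ^ 2 | ℱ k] ≤ᵐ[P] P[Δ k | ℱ k]
  recursion : ∀ k, 1 ≤ k → ∀ᵐ ω ∂P,
    1 / (1 - γ k) ^ 2 * (P[Δ k | ℱ k]) ω
      ≤ (1 - ρ) / (1 - γ (k - 1)) ^ 2 * Δ (k - 1) ω
        + Θ / (1 - γ k) ^ 2 * variation G x k ω
        + Θhat / (1 - γ (k - 1)) ^ 2 * variation G x (k - 1) ω

/-- The direction
`Su^k + (1/lam) (x^k - u^k) - (γ_k/lam) (x^{k-1} - u^{k-1})` of the method, built from an estimator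
`Su^k` of `G u^k - γ_k G u^{k-1}`. -/
def direction {p : ℕ} (lam : ℝ) (γ : ℕ → ℝ) (x u Su : ℕ → Ω → Vec p)
    (k : ℕ) (ω : Ω) : Vec p :=
  Su k ω + (1 / lam) • (x k ω - u k ω) - (γ k / lam) • (x (k - 1) ω - u (k - 1) ω)

/-- The pair `(x, u)` is generated from `x0` by the variance-reduced fast backward-forward
splitting method with the estimators `Su`. -/
structure IsVFBFS {n p : ℕ} (G : Fin n → Vec p → Vec p) (T : Vec p → Set (Vec p)) (lam : ℝ)
    (θ γ η : ℕ → ℝ) (x0 : Vec p) (x u Su : ℕ → Ω → Vec p) : Prop where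
  init : ∀ ω, x 0 ω = x0
  u_eq : ∀ k ω, u k ω = opResolvent T lam (x k ω)
  Su_zero : ∀ ω, Su 0 ω = target G γ u 0 ω
  step : ∀ k ω, x (k + 1) ω = x k ω + θ k • (x k ω - x (k - 1) ω)
    - η k • direction lam γ x u Su k ω

/-! ### The conclusions -/

/-- Summability bound `∑ k, (2k + r + 3) E[Q_k] ≤ c`, where all expectations exist. -/
structure SumBound (P : Measure Ω) (r c : ℝ) (Q : ℕ → Ω → ℝ) : Prop where
  integrable : ∀ k, Integrable (Q k) P
  summable : Summable fun k : ℕ => (2 * (k : ℝ) + r + 3) * ∫ ω, Q k ω ∂P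
  tsum_le : ∑' k : ℕ, (2 * (k : ℝ) + r + 3) * ∫ ω, Q k ω ∂P ≤ c

/-- The bounds for a squared increment `Q_k`; `R2` stands for `‖x^0 - x^⋆‖²`. -/
structure IncrementBounds (P : Measure Ω) (L r β ρ Θs R2 : ℝ) (Q : ℕ → Ω → ℝ) : Prop where
  sum_bound : SumBound P r (C0 L r β * R2) Q
  rate : ∀ k : ℕ, ∫ ω, Q k ω ∂P ≤ C2 L r β ρ Θs * R2 / ((k : ℝ) + r + 2) ^ 2

/-- The bounds for a squared residual `Q_k`; `R2` stands for `‖x^0 - x^⋆‖²`. The last field is the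
`O(1/ε)` iteration complexity, with an explicit constant. -/
structure ResidualBounds (P : Measure Ω) (L r β ρ Θs R2 : ℝ) (Q : ℕ → Ω → ℝ) : Prop where
  sum_bound : SumBound P r
    ((r + 2) ^ 2 / (2 * β ^ 2 * r ^ 2) * (C0 L r β + 2 * C1 L r β ρ Θs / (r - 2)) * R2) Q
  rate : ∀ k : ℕ, ∫ ω, Q k ω ∂P
    ≤ C3 L r β ρ Θs * R2 / (β ^ 2 * ((k : ℝ) + r - 1) * ((k : ℝ) + r + 2))
  complexity : ∀ ε : ℝ, 0 < ε → ∀ k : ℕ,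
    (Real.sqrt (C3 L r β ρ Θs * R2) / β) * (1 / ε) ≤ k → ∫ ω, Q k ω ∂P ≤ ε ^ 2

/-- The `o(1/k²)` rates of `Q_k`, in expectation and almost surely. -/
structure SmallORates (P : Measure Ω) (Q : ℕ → Ω → ℝ) : Prop where
  expectation : Tendsto (fun k : ℕ => (k : ℝ) ^ 2 * ∫ ω, Q k ω ∂P) atTop (𝓝 0)
  almost_sure : ∀ᵐ ω ∂P, Tendsto (fun k : ℕ => (k : ℝ) ^ 2 * Q k ω) atTop (𝓝 0)

end Stochastic

end VFKM

end

open VFKM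

/-! Why the theorem holds. The method is an accelerated Krasnoselskii–Mann iteration for the average
`H` of the operators `bfsComp`. The structure of `G` and `T` enters only through two facts. The
resolvent is everywhere defined, single-valued and nonexpansive (`exists_inner_le_zero`,
`IsCohypomonotone.norm_resolvent_sub_le`), and every `bfsComp` is `1/L`-co-coercive
(`bfsComp_cocoercive`). All claims about `u` and `fbsResidual` then follow by nonexpansiveness.

For the iteration put `d_k = x^k - x^{k-1}` and let `e_k` be the estimation error. Then `(k+r+2)
d_{k+1}` is a quantity known at time `k` minus `2β(k+r) e_k`. The Lyapunov identity `energy_step`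
produces the decrease terms `(2k+r+3)‖d_{k+1}‖²` and, by co-coercivity, `4βk(k+r)(1/L-β) U_k`. The
noise is centred given the past, so in expectation only its square, weighted by `4β²(k+r)²`,
survives. Since `1 - γ_k = r/(k+r)`, the variance recursion carries exactly this weight: the
accumulated noise is at most `(Θ+Θhat)/ρ` times the sum of `(k+r)² E U_k`. The bound on `β` lets the
decrease absorb it, with `Lam` left over (`sum_energy_le`).

The velocity `d_k + 2βH x^{k-1}` obeys a second recursion, driven by summable terms, which
telescopes with a surplus because `r > 2` (`velocity_bounds`). Velocity minus increment is `2βH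
x^{k-1}`, which gives the residual bounds; a third recursion then bounds each increment
(`increment_bound`).

For the small-o rates, `k²` times a squared velocity or increment grows only by summable terms and
martingale differences, hence converges; summability with weight `k` forces the limit to be zero.
Likewise the energy converges almost surely for each fixed zero, and by the rates it differs from
`r(r+1)‖x^k - x^⋆‖²` by a vanishing amount. Opial's argument along a countable dense set of zeros
gives convergence of `x^k`. -/

namespace VFKM

/-! ### Monotone operators and resolvents -/

/-! ### Minty's theorem by minimax and compactness. -/

section Minty

variable {E : Type*} [NormedAddCommGroup E] [InnerProductSpace ℝ E]

/-- The function is `‖w‖²` plus an affine function, so its convexity defect is that of `‖w‖²`. -/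
lemma convexOn_inner_sub_add (a b : E) (s : Set E) (hs : Convex ℝ s) :
    ConvexOn ℝ s fun w => inner ℝ (w - a) (w + b) := by
  refine ⟨hs, fun x _ y _ α β hα hβ hαβ => ?_⟩
  have key : α * inner ℝ (x - a) (x + b) + β * inner ℝ (y - a) (y + b)
      - inner ℝ (α • x + β • y - a) (α • x + β • y + b) = α * β * ‖x - y‖ ^ 2 := by
    obtain rfl : β = 1 - α := by linarith
    rw [← real_inner_self_eq_norm_sq]
    simp only [inner_add_left, inner_add_right, inner_sub_left, inner_sub_right,
      real_inner_smul_left, real_inner_smul_right]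
    rw [real_inner_comm x y]
    ring
  have : 0 ≤ α * β * ‖x - y‖ ^ 2 := by positivity
  simp only [smul_eq_mul]
  linarith

/-- For a finite monotone family, the averaged form of the Minty inequality. -/
lemma sum_inner_midpoint_nonpos {ι : Type*} [Fintype ι] (a b : ι → E)
    (h : ∀ i j, 0 ≤ inner ℝ (a i - a j) (b i - b j)) (p : ι → ℝ) (hp : p ∈ stdSimplex ℝ ι) :
    ∑ i, p i * inner ℝ ((1 / 2 : ℝ) • ∑ j, p j • (a j - b j) - a i)
      ((1 / 2 : ℝ) • (∑ j, p j • (a j - b j)) + b i) ≤ 0 := by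
  set A := ∑ j, p j • a j with hA
  set B := ∑ j, p j • b j with hB
  have hAB : ∑ j, p j • (a j - b j) = A - B := by
    simp only [smul_sub, Finset.sum_sub_distrib, hA, hB]
  rw [hAB]
  set w := (1 / 2 : ℝ) • (A - B) with hw
  have e1 : ∀ v : E, ∑ i, p i * inner ℝ v (b i) = inner ℝ v B := fun v => by
    simp only [hB, inner_sum, real_inner_smul_right]
  have e2 : ∀ v : E, ∑ i, p i * inner ℝ (a i) v = inner ℝ A v := fun v => by
    simp only [hA, sum_inner, real_inner_smul_left]
  have hdouble : 0 ≤ ∑ i, p i * ∑ j, p j * inner ℝ (a i - a j) (b i - b j) :=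
    Finset.sum_nonneg fun i _ => mul_nonneg (hp.1 i) <| Finset.sum_nonneg fun j _ =>
      mul_nonneg (hp.1 j) (h i j)
  have hin : ∀ i, ∑ j, p j * inner ℝ (a i - a j) (b i - b j)
      = inner ℝ (a i) (b i) - inner ℝ (a i) B - inner ℝ A (b i)
        + ∑ j, p j * inner ℝ (a j) (b j) := fun i => by
    simp only [inner_sub_left, inner_sub_right, mul_sub, Finset.sum_sub_distrib, e1, e2,
      ← Finset.sum_mul, hp.2]
    ring
  set K := ∑ j, p j * inner ℝ (a j) (b j) with hK
  -- The double sum equals `2 (K - ⟪A, B⟫)`: monotonicity makes the covariance of `a` and `b` under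
  -- `p` nonnegative. At the minimiser `w = (A - B)/2` the averaged value is `⟪A, B⟫ - K - ‖A +
  -- B‖²/4`.
  have hmono : inner ℝ A B ≤ K := by
    simp only [hin, mul_add, mul_sub, Finset.sum_add_distrib, Finset.sum_sub_distrib, e1, e2,
      ← Finset.sum_mul, hp.2, ← hK] at hdouble
    linarith
  have hexp : ∑ i, p i * inner ℝ (w - a i) (w + b i)
      = inner ℝ w w + inner ℝ w B - inner ℝ A w - K := by
    simp only [inner_sub_left, inner_add_right, mul_add, mul_sub, Finset.sum_add_distrib,
      Finset.sum_sub_distrib, e1, e2, ← Finset.sum_mul, hp.2, ← hK]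
    ring
  have hsq : inner ℝ w w + inner ℝ w B - inner ℝ A w - inner ℝ A B
      = -(1 / 4) * ‖A + B‖ ^ 2 := by
    rw [← real_inner_self_eq_norm_sq, hw]
    simp only [inner_add_left, inner_add_right, inner_sub_left, inner_sub_right,
      real_inner_smul_left, real_inner_smul_right]
    rw [real_inner_comm A B]
    ring
  rw [hexp]
  nlinarith [sq_nonneg ‖A + B‖]

/-- Take a saddle point `(w, q)` of the payoff `∑ p i ⟪w - a i, w + b i⟫`, convex in `w` and linear
in `p`. Against `q`, the midpoint response already makes the payoff nonpositive, so at `w` every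
vertex of the simplex pays at most zero. -/
lemma exists_inner_le_zero_of_fintype [FiniteDimensional ℝ E] {ι : Type*} [Fintype ι]
    (a b : ι → E) (h : ∀ i j, 0 ≤ inner ℝ (a i - a j) (b i - b j)) :
    ∃ w, ∀ i, inner ℝ (w - a i) (w + b i) ≤ 0 := by
  classical
  cases isEmpty_or_nonempty ι with
  | inl _ => exact ⟨0, fun i => isEmptyElim i⟩
  | inr hne =>
  -- The ball only has to be compact and to contain all the midpoint responses.
  let R := ∑ j, ‖a j - b j‖
  let f : E → (ι → ℝ) → ℝ := fun w p => ∑ i, p i * inner ℝ (w - a i) (w + b i)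
  have hR : 0 ≤ R := Finset.sum_nonneg fun _ _ => norm_nonneg _
  obtain ⟨w, hw, q, hq, hs⟩ := Sion.exists_isSaddlePointOn
    (X := Metric.closedBall (0 : E) R) (Y := stdSimplex ℝ ι) (f := f)
    ⟨0, by simpa using hR⟩ (convex_closedBall _ _) (isCompact_closedBall _ _)
    (fun p _ => (Continuous.lowerSemicontinuous (by fun_prop)).lowerSemicontinuousOn _)
    (fun p hp => by
      refine ConvexOn.quasiconvexOn ?_
      have := Finset.sum_induction (s := (Finset.univ : Finset ι))
        (fun i => fun w : E => p i * inner ℝ (w - a i) (w + b i))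
        (fun g => ConvexOn ℝ (Metric.closedBall (0 : E) R) g) (fun _ _ => ConvexOn.add)
        (convexOn_const _ (convex_closedBall _ _))
        (fun i _ => (convexOn_inner_sub_add (a i) (b i) _ (convex_closedBall _ _)).smul (hp.1 i))
      have e : (fun w => f w p) = ∑ i, fun w : E => p i * inner ℝ (w - a i) (w + b i) := by
        funext w
        simp [f]
      exact e ▸ this)
    (convex_stdSimplex ℝ ι) ⟨_, single_mem_stdSimplex ℝ hne.some⟩ (isCompact_stdSimplex ℝ ι)
    (fun x _ => (Continuous.upperSemicontinuous (by fun_prop)).upperSemicontinuousOn _)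
    (fun x _ => by
      refine ConcaveOn.quasiconcaveOn ⟨convex_stdSimplex ℝ ι, fun p _ q _ α β _ _ _ => le_of_eq ?_⟩
      simp only [f, smul_eq_mul, Pi.add_apply, Pi.smul_apply, Finset.mul_sum, add_mul,
        Finset.sum_add_distrib, mul_assoc])
  refine ⟨w, fun i => ?_⟩
  have hmem : (1 / 2 : ℝ) • ∑ j, q j • (a j - b j) ∈ Metric.closedBall (0 : E) R := by
    rw [mem_closedBall_zero_iff, norm_smul]
    have : ‖∑ j, q j • (a j - b j)‖ ≤ R := by
      refine norm_sum_le_of_le _ fun j _ => ?_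
      rw [norm_smul, Real.norm_of_nonneg (hq.1 j)]
      have : q j ≤ 1 := hq.2 ▸ Finset.single_le_sum (fun i _ => hq.1 i) (Finset.mem_univ j)
      exact mul_le_of_le_one_left (norm_nonneg _) this
    norm_num
    linarith
  have h1 := hs _ hmem _ (single_mem_stdSimplex ℝ i)
  have h2 := sum_inner_midpoint_nonpos a b h q hq
  have h3 : f w (Pi.single i 1) = inner ℝ (w - a i) (w + b i) := by
    simp [f, Pi.single_apply]
  rw [← h3]
  exact h1.trans h2

/-- **Minty's theorem** in inequality form. -/
lemma exists_inner_le_zero [FiniteDimensional ℝ E] {ι : Type*}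
    (a b : ι → E) (h : ∀ i j, 0 ≤ inner ℝ (a i - a j) (b i - b j)) :
    ∃ w, ∀ i, inner ℝ (w - a i) (w + b i) ≤ 0 := by
  cases isEmpty_or_nonempty ι with
  | inl _ => exact ⟨0, fun i => isEmptyElim i⟩
  | inr hne =>
  let C : ι → Set E := fun i => {w | inner ℝ (w - a i) (w + b i) ≤ 0}
  -- The constraint of index `i` describes the ball having the segment from `a i` to `-b i` as
  -- diameter. The finite case and the finite intersection property then suffice.
  have hball : ∀ i, C i = Metric.closedBall ((1 / 2 : ℝ) • (a i - b i)) (1 / 2 * ‖a i + b i‖) := by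
    intro i
    ext w
    have : inner ℝ (w - a i) (w + b i)
        = ‖w - (1 / 2 : ℝ) • (a i - b i)‖ ^ 2 - (1 / 2 * ‖a i + b i‖) ^ 2 := by
      rw [mul_pow, ← real_inner_self_eq_norm_sq, ← real_inner_self_eq_norm_sq]
      simp only [inner_add_left, inner_add_right, inner_sub_left, inner_sub_right,
        real_inner_smul_left, real_inner_smul_right]
      rw [real_inner_comm (a i) (b i), real_inner_comm (a i) w, real_inner_comm (b i) w]
      ring
    simp only [C, Set.mem_ofPred_eq, this, mem_closedBall_iff_norm, sub_nonpos]
    exact pow_le_pow_iff_left₀ (norm_nonneg _) (by positivity) two_ne_zero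
  have hclosed : ∀ i, IsClosed (C i) := fun i => hball i ▸ Metric.isClosed_closedBall
  have hcomp : IsCompact (C hne.some) := hball _ ▸ isCompact_closedBall _ _
  obtain ⟨w, -, hw⟩ := hcomp.inter_iInter_nonempty C hclosed fun s => by
    -- The index `none` stands for the distinguished ball that supplies compactness.
    obtain ⟨w, hw⟩ := exists_inner_le_zero_of_fintype
      (fun i : Option s => a (i.elim hne.some (↑)))
      (fun i : Option s => b (i.elim hne.some (↑))) (fun i j => h _ _)
    exact ⟨w, hw none, Set.mem_iInter₂.2 fun i hi => hw (some ⟨i, hi⟩)⟩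
  exact ⟨w, fun i => Set.mem_iInter.1 hw i⟩

end Minty

/-! ### Resolvents of co-hypomonotone operators. -/

section Resolvent

variable {p : ℕ} {T : Vec p → Set (Vec p)} {ν lam : ℝ}

/-- Expanding `‖x - y‖²` and using co-hypomonotonicity leaves `‖u - v‖² + lam (lam - 2ν) ‖z - w‖²`
as a lower bound; this is where `2ν ≤ lam` is used. -/
lemma IsCohypomonotone.norm_resolvent_sub_le (hT : IsCohypomonotone ν T) (hlam : 0 < lam)
    (hν : 2 * ν ≤ lam) {x y u v : Vec p} (hu : u ∈ opResolventSet T lam x)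
    (hv : v ∈ opResolventSet T lam y) : ‖u - v‖ ≤ ‖x - y‖ := by
  obtain ⟨z, hz, rfl⟩ := hu
  obtain ⟨w, hw, rfl⟩ := hv
  have h := hT u v z w hz hw
  have e : ‖u + lam • z - (v + lam • w)‖ ^ 2
      = ‖u - v‖ ^ 2 + 2 * lam * inner ℝ (z - w) (u - v) + lam ^ 2 * ‖z - w‖ ^ 2 := by
    rw [show u + lam • z - (v + lam • w) = (u - v) + lam • (z - w) by module,
      norm_add_sq_real, norm_smul, mul_pow, Real.norm_eq_abs, sq_abs, real_inner_smul_right,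
      real_inner_comm]
    ring
  refine (sq_le_sq₀ (norm_nonneg _) (norm_nonneg _)).1 ?_
  rw [e]
  have h1 := mul_le_mul_of_nonneg_left h (by positivity : 0 ≤ 2 * lam)
  have h2 : 0 ≤ lam * (lam - 2 * ν) * ‖z - w‖ ^ 2 :=
    mul_nonneg (mul_nonneg hlam.le (by linarith)) (sq_nonneg _)
  nlinarith

/-- Co-hypomonotonicity of `T` is monotonicity of the pairs `(u + ν z, z)` with `z ∈ T u`. Minty's
inequality for these pairs, at step `τ = lam - ν`, yields a point `(u, z)` with `u + lam z = y` that
is compatible with the graph of `T`, and maximality places it in the graph. -/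
lemma IsMaximallyCohypomonotone.opResolventSet_nonempty (hT : IsMaximallyCohypomonotone ν T)
    (hν : 0 ≤ ν) (hlam : 0 < lam) (hlam' : 2 * ν ≤ lam) (y : Vec p) :
    (opResolventSet T lam y).Nonempty := by
  have hτ : 0 < lam - ν := by rcases hν.eq_or_lt with rfl | h <;> linarith
  set τ := lam - ν with hτdef
  let ι := {q : Vec p × Vec p // q.2 ∈ T q.1}
  have hid : ∀ (u v z w : Vec p), inner ℝ ((u + ν • z) - (v + ν • w)) (z - w)
      = inner ℝ (z - w) (u - v) + ν * ‖z - w‖ ^ 2 := fun u v z w => by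
    rw [show (u + ν • z) - (v + ν • w) = (u - v) + ν • (z - w) by module, inner_add_left,
      real_inner_smul_left, real_inner_self_eq_norm_sq, real_inner_comm]
  obtain ⟨w, hw⟩ := exists_inner_le_zero (ι := ι) (fun q => q.1.1 + ν • q.1.2)
    (fun q => τ • q.1.2 - y) (fun i j => by
      have h := hT.1 _ _ _ _ i.2 j.2
      rw [show (τ • i.1.2 - y) - (τ • j.1.2 - y) = τ • (i.1.2 - j.1.2) by module,
        real_inner_smul_right, hid]
      exact mul_nonneg hτ.le (by linarith))
  set z := (1 / τ) • (y - w) with hz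
  set u := w - ν • z with hu
  have hmono : ∀ v z', z' ∈ T v → -ν * ‖z - z'‖ ^ 2 ≤ inner ℝ (z - z') (u - v) := by
    intro v z' hz'
    have h := hw ⟨(v, z'), hz'⟩
    have e : w + (τ • z' - y) = -(τ • (z - z')) := by
      rw [hz, smul_sub, smul_smul, mul_one_div_cancel hτ.ne']
      module
    have e2 : w - (v + ν • z') = (u + ν • z) - (v + ν • z') := by rw [hu]; module
    simp only at h
    rw [e, inner_neg_right, real_inner_smul_right, e2, hid] at h
    have : 0 ≤ τ * (inner ℝ (z - z') (u - v) + ν * ‖z - z'‖ ^ 2) := by linarith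
    have := nonneg_of_mul_nonneg_right this hτ
    linarith
  -- `T'` adjoins the single pair `(u, z)` to the graph.
  let T' : Vec p → Set (Vec p) := fun v => T v ∪ {s | v = u ∧ s = z}
  have hT' : IsCohypomonotone ν T' := by
    rintro v v' s s' (hs | ⟨rfl, rfl⟩) (hs' | ⟨rfl, rfl⟩)
    · exact hT.1 _ _ _ _ hs hs'
    · have := hmono v s hs
      rwa [← inner_neg_neg, neg_sub, neg_sub, norm_sub_rev]
    · exact hmono v' s' hs'
    · simp
  have hEq := hT.2 T' hT' fun v => Set.subset_union_left
  refine ⟨u, z, hEq ▸ Or.inr ⟨rfl, rfl⟩, ?_⟩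
  have : τ • z = y - w := by rw [hz, smul_smul, mul_one_div_cancel hτ.ne', one_smul]
  calc u + lam • z = w + τ • z := by rw [hu, hτdef]; module
    _ = y := by rw [this]; module

variable (hT : IsMaximallyCohypomonotone ν T) (hν : 0 ≤ ν) (hlam : 0 < lam) (hlam' : 2 * ν ≤ lam)
include hT hν hlam hlam'

lemma opResolvent_mem (y : Vec p) : opResolvent T lam y ∈ opResolventSet T lam y :=
  Classical.epsilon_spec (hT.opResolventSet_nonempty hν hlam hlam' y)

lemma opResolventSet_eq_singleton (y : Vec p) :
    opResolventSet T lam y = {opResolvent T lam y} := by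
  refine Set.eq_singleton_iff_unique_mem.2 ⟨opResolvent_mem hT hν hlam hlam' y, fun u hu => ?_⟩
  have := hT.1.norm_resolvent_sub_le hlam hlam' hu (opResolvent_mem hT hν hlam hlam' y)
  simpa [sub_eq_zero] using this

lemma norm_opResolvent_sub_le (x y : Vec p) :
    ‖opResolvent T lam x - opResolvent T lam y‖ ≤ ‖x - y‖ :=
  hT.1.norm_resolvent_sub_le hlam hlam' (opResolvent_mem hT hν hlam hlam' x)
    (opResolvent_mem hT hν hlam hlam' y)

lemma continuous_opResolvent : Continuous (opResolvent T lam) :=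
  (LipschitzWith.of_dist_le_mul (K := 1) fun x y => by
    simpa [dist_eq_norm] using norm_opResolvent_sub_le hT hν hlam hlam' x y).continuous

/-! ### Residuals and solutions. -/

variable {n : ℕ} {G : Fin n → Vec p → Vec p}

omit hT hν hlam hlam' in
lemma bfs_eq (hn : 0 < n) (x : Vec p) : bfs G T lam x
    = avg G (opResolvent T lam x) + (1 / lam) • (x - opResolvent T lam x) := by
  have : (n : ℝ) ≠ 0 := by positivity
  simp only [bfs, avg, bfsComp, Finset.sum_add_distrib, Finset.sum_const, Finset.card_univ,
    Fintype.card_fin, smul_add, ← Nat.cast_smul_eq_nsmul ℝ, smul_smul]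
  field_simp

/-- With `u = J x`, the two residuals times `lam` are `J x - J (u - lam G u)` and `x - (u - lam G
u)`. -/
lemma norm_fbsResidual_le (hn : 0 < n) (x : Vec p) :
    ‖fbsResidual G T lam (opResolvent T lam x)‖ ≤ ‖bfs G T lam x‖ := by
  set u := opResolvent T lam x with hu
  have e : bfs G T lam x = (1 / lam) • (x - (u - lam • avg G u)) := by
    rw [bfs_eq hn, ← hu, sub_sub_eq_add_sub, add_sub_right_comm, smul_add, smul_smul,
      one_div_mul_cancel hlam.ne', one_smul, add_comm]
  rw [e, fbsResidual, norm_smul, norm_smul]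
  exact mul_le_mul_of_nonneg_left (norm_opResolvent_sub_le hT hν hlam hlam' _ _) (norm_nonneg _)

lemma opResolvent_mem_zerSum (hn : 0 < n) {x : Vec p} (hx : bfs G T lam x = 0) :
    opResolvent T lam x ∈ zerSum (avg G) T := by
  obtain ⟨z, hz, hzx⟩ := opResolvent_mem hT hν hlam hlam' x
  refine ⟨z, hz, ?_⟩
  have e : x - opResolvent T lam x = lam • z := by
    nth_rewrite 1 [← hzx]; module
  rwa [bfs_eq hn, e, smul_smul, one_div_mul_cancel hlam.ne', one_smul] at hx

lemma exists_bfs_eq_zero (hn : 0 < n) (hz : (zerSum (avg G) T).Nonempty) :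
    ∃ x, bfs G T lam x = 0 := by
  obtain ⟨u, z, hz, hu⟩ := hz
  have hmem : u ∈ opResolventSet T lam (u + lam • z) := ⟨z, hz, rfl⟩
  rw [opResolventSet_eq_singleton hT hν hlam hlam'] at hmem
  refine ⟨u + lam • z, ?_⟩
  rw [bfs_eq hn, ← Set.mem_singleton_iff.1 hmem, add_sub_cancel_left, smul_smul,
    one_div_mul_cancel hlam.ne', one_smul, hu]

/-! ### The co-coercivity constant of the backward-forward operators. -/

variable {Lg : ℝ} (hLg : 0 < Lg) (hLgν : Lg * ν < 1)
  (hlam_upper : lam < 2 * (1 + Real.sqrt (1 - Lg * ν)) / Lg)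

-- With `s = √(1 - Lg ν)`, `Lg` times the denominator factors as `(lam Lg - 2(1 - s)) (2(1 + s) -
-- lam Lg)`. The second factor is positive by the upper bound on `lam`. For the first, when `ν > 0`,
-- the bound `2ν ≤ lam` gives `lam Lg ≥ 2(1 - s)(1 + s)`.
omit hT in
include hν hlam hlam' hLg hLgν hlam_upper in
lemma bfsL_denom_pos : 0 < lam * (4 - Lg * lam) - 4 * ν := by
  set s := Real.sqrt (1 - Lg * ν) with hs
  have hs2 : s ^ 2 = 1 - Lg * ν := Real.sq_sqrt (by linarith)
  have hs0 : 0 < s := Real.sqrt_pos.2 (by linarith)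
  rw [lt_div_iff₀ hLg] at hlam_upper
  have h2 : 2 * (1 - s) < lam * Lg := by
    rcases hν.eq_or_lt with rfl | h
    · have : s = 1 := by
        have : s ^ 2 = 1 := by simpa using hs2
        nlinarith
      rw [this]; nlinarith
    · have : (1 - s) * (1 + s) = Lg * ν := by nlinarith
      have hs1 : 0 < 1 - s := by
        by_contra hc
        nlinarith [mul_pos hLg h]
      nlinarith
  have : 0 < (lam * Lg - 2 * (1 - s)) * (2 * (1 + s) - lam * Lg) :=
    mul_pos (by linarith) (by linarith)
  have e : (lam * Lg - 2 * (1 - s)) * (2 * (1 + s) - lam * Lg)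
      = Lg * (lam * (4 - Lg * lam) - 4 * ν) := by
    have : s ^ 2 = 1 - Lg * ν := hs2
    linear_combination 4 * this
  rw [e] at this
  exact pos_of_mul_pos_right this hLg.le

omit hT in
include hν hlam hlam' hLg hLgν hlam_upper in
lemma bfsL_pos : 0 < bfsL Lg ν lam :=
  div_pos (by linarith) (bfsL_denom_pos hν hlam hlam' hLg hLgν hlam_upper)

-- Let `g` and `q` be the differences of the values of `G i` and of the elements of `T`. The claim
-- reduces to nonnegativity of a quadratic form in `(g, q)` with coefficients `A`, `2B`, `C`, and `1
-- / L` is exactly the value of `μ` at which its determinant `A * C - B ^ 2` vanishes.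
include hLg hLgν hlam_upper in
lemma bfsComp_cocoercive (hG : ∀ i, IsCocoercive Lg (G i)) (i : Fin n) :
    IsCocoercive (bfsL Lg ν lam) (bfsComp G T lam i) := by
  intro x y
  obtain ⟨z, hz, hzx⟩ := opResolvent_mem hT hν hlam hlam' x
  obtain ⟨w, hw, hwy⟩ := opResolvent_mem hT hν hlam hlam' y
  have hT1 := hT.1 _ _ _ _ hz hw
  have hG1 := hG i (opResolvent T lam x) (opResolvent T lam y)
  simp only [bfsComp]
  set u := opResolvent T lam x
  set v := opResolvent T lam y
  rw [show G i u + (1 / lam) • (x - u) = G i u + z by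
      rw [← eq_sub_of_add_eq' hzx, smul_smul, one_div_mul_cancel hlam.ne', one_smul],
    show G i v + (1 / lam) • (y - v) = G i v + w by
      rw [← eq_sub_of_add_eq' hwy, smul_smul, one_div_mul_cancel hlam.ne', one_smul]]
  set g := G i u - G i v with hg
  set q := z - w with hq
  rw [show G i u + z - (G i v + w) = g + q by rw [hg, hq]; module,
    show x - y = (u - v) + lam • q by
      rw [hq, smul_sub, eq_sub_of_add_eq' hzx, eq_sub_of_add_eq' hwy]; abel]
  have e1 : inner ℝ (g + q) ((u - v) + lam • q)
      = inner ℝ g (u - v) + inner ℝ q (u - v) + lam * inner ℝ g q + lam * ‖q‖ ^ 2 := by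
    rw [inner_add_left, inner_add_right, inner_add_right, real_inner_smul_right,
      real_inner_smul_right, real_inner_self_eq_norm_sq]
    ring
  rw [e1, norm_add_sq_real]
  have hden := bfsL_denom_pos hν hlam hlam' hLg hLgν hlam_upper
  set μ := 1 / bfsL Lg ν lam with hμ
  have hμ' : μ * (4 * (1 - Lg * ν)) = lam * (4 - Lg * lam) - 4 * ν := by
    rw [hμ, bfsL, one_div_div, div_mul_cancel₀ _ (by linarith)]
  set A := 1 / Lg - μ with hA
  set B := lam / 2 - μ with hB
  set C := lam - ν - μ with hC
  have h1 : 0 < 1 - Lg * ν := by linarith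
  have hLA : Lg * (1 / Lg) = 1 := mul_one_div_cancel hLg.ne'
  have hdet : A * C = B ^ 2 := by
    have : Lg * (A * C - B ^ 2) = 0 := by
      rw [hA, hB, hC]
      linear_combination (lam - ν - μ) * hLA - 1 / 4 * hμ'
    rcases mul_eq_zero.1 this with h | h <;> linarith
  have hA0 : 0 ≤ A := by
    have : 4 * (1 - Lg * ν) * (Lg * A) = (Lg * lam - 2) ^ 2 := by
      rw [hA]
      linear_combination 4 * (1 - Lg * ν) * hLA - Lg * hμ'
    have : 0 ≤ 4 * (1 - Lg * ν) * (Lg * A) := this ▸ sq_nonneg _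
    exact nonneg_of_mul_nonneg_right (nonneg_of_mul_nonneg_right this (by linarith)) hLg
  have hC0 : 0 ≤ C := by
    have : 4 * (1 - Lg * ν) * C = (lam - 2 * ν) ^ 2 * Lg := by
      have h4 : 4 * (1 - Lg * ν) * C
        = 4 * (1 - Lg * ν) * (lam - ν) - (lam * (4 - Lg * lam) - 4 * ν) := by
        rw [hC]; linear_combination - hμ'
      rw [h4]; ring
    have : 0 ≤ 4 * (1 - Lg * ν) * C := this ▸ by positivity
    exact nonneg_of_mul_nonneg_right this (by linarith)
  have hquad : 0 ≤ A * ‖g‖ ^ 2 + 2 * B * inner ℝ g q + C * ‖q‖ ^ 2 := by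
    rcases hA0.eq_or_lt with h | h
    · have hB0 : B = 0 := by
        have : B ^ 2 = 0 := by rw [← hdet, ← h, zero_mul]
        simpa using this
      rw [← h, hB0]
      have := mul_nonneg hC0 (sq_nonneg ‖q‖)
      linarith
    · have : A * (A * ‖g‖ ^ 2 + 2 * B * inner ℝ g q + C * ‖q‖ ^ 2) = ‖A • g + B • q‖ ^ 2 := by
        rw [norm_add_sq_real, norm_smul, norm_smul, mul_pow, mul_pow, Real.norm_eq_abs,
          Real.norm_eq_abs, sq_abs, sq_abs, real_inner_smul_left, real_inner_smul_right]
        linear_combination ‖q‖ ^ 2 * hdet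
      exact nonneg_of_mul_nonneg_right (this ▸ sq_nonneg _) h
  rw [hA, hB, hC] at hquad
  nlinarith

end Resolvent

/-! ### One step of the method -/

section OneStep

variable {E : Type*} [NormedAddCommGroup E] [InnerProductSpace ℝ E]

/-- The Lyapunov function: `y = x^k - x^⋆`, `d = x^k - x^{k-1}` and `g` is the residual
at `x^{k-1}`. -/
noncomputable def energy (r β k : ℝ) (y d g : E) : ℝ :=
  ‖r • y + k • d‖ ^ 2 + r * ‖y‖ ^ 2 + 4 * β * k * r * (inner ℝ g (y - d) - β * ‖g‖ ^ 2)

/-- The scaled noiseless increment, where `h` and `g` are the residuals at `x^k` and `x^{k-1}`. -/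
noncomputable def drift (r β k : ℝ) (d g h : E) : E :=
  k • d - (2 * β * (k + r)) • h + (2 * β * k) • g

variable {r β k : ℝ} {y d g h e d' : E}

/-- An exact identity, with no co-coercivity used: the two subtracted brackets become nonnegative
once `β ≤ 1/L`. The noise is paired only with `drift` and `y`, never with `d'`, so its partner is
known before the estimator is drawn. -/
lemma energy_step (h' : (k + r + 2) • d' = drift r β k d g h - (2 * β * (k + r)) • e) :
    energy r β (k + 1) (y + d') d' h + (2 * k + r + 3) * ‖d'‖ ^ 2
      = energy r β k y d g - 4 * β * r * (r - 1) * (inner ℝ h y - β * ‖h‖ ^ 2)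
        - 4 * β * k * (k + r) * (inner ℝ (h - g) d - β * ‖h - g‖ ^ 2)
        - inner ℝ e ((4 * β * (k + r)) • (drift r β k d g h + r • y))
        + 4 * β ^ 2 * (k + r) ^ 2 * ‖e‖ ^ 2 := by
  have hD : drift r β k d g h = (k + r + 2) • d' + (2 * β * (k + r)) • e := by
    rw [h']; module
  have hkd : k • d = (k + r + 2) • d' + (2 * β * (k + r)) • e
      + (2 * β * (k + r)) • h - (2 * β * k) • g := by
    rw [← hD, drift]; module
  have e1 : energy r β k y d g = ‖r • y + k • d‖ ^ 2 + r * ‖y‖ ^ 2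
      + 4 * β * r * (k * inner ℝ g y - inner ℝ g (k • d) - β * k * ‖g‖ ^ 2) := by
    rw [energy, inner_sub_right, real_inner_smul_right]; ring
  have e2 : 4 * β * k * (k + r) * (inner ℝ (h - g) d - β * ‖h - g‖ ^ 2)
      = 4 * β * (k + r) * (inner ℝ (h - g) (k • d) - β * k * ‖h - g‖ ^ 2) := by
    rw [real_inner_smul_right]; ring
  rw [e1, e2, hD, hkd, energy]
  simp only [← real_inner_self_eq_norm_sq]
  simp only [inner_add_left, inner_add_right, inner_sub_left, inner_sub_right,
    real_inner_smul_left, real_inner_smul_right]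
  rw [real_inner_comm d' y, real_inner_comm e y, real_inner_comm h y, real_inner_comm g y,
    real_inner_comm d' h, real_inner_comm d' g, real_inner_comm d' e, real_inner_comm e h,
    real_inner_comm e g, real_inner_comm g h]
  ring

lemma energy_eq_zero_index (y d g : E) : energy r β 0 y d g = r * (r + 1) * ‖y‖ ^ 2 := by
  simp only [energy, zero_smul, add_zero, norm_smul, mul_pow, Real.norm_eq_abs, sq_abs]
  ring

lemma mul_norm_sq_le_energy (hβ : 0 ≤ β) (hk : 0 ≤ k) (hr : 0 ≤ r)
    (hg : β * ‖g‖ ^ 2 ≤ inner ℝ g (y - d)) : r * ‖y‖ ^ 2 ≤ energy r β k y d g := by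
  have : 0 ≤ 4 * β * k * r * (inner ℝ g (y - d) - β * ‖g‖ ^ 2) :=
    mul_nonneg (by positivity) (by linarith)
  rw [energy]
  nlinarith [sq_nonneg ‖r • y + k • d‖]

/-- By `hco`, the reflected increment `c = d - 2β(h - g)` is no longer than `d`, and the drift is `k
c - 2βr h`. -/
lemma increment_step (hβ : 0 ≤ β) (hk : 0 ≤ k) (hr : 0 < r)
    (hco : β * ‖h - g‖ ^ 2 ≤ inner ℝ (h - g) d)
    (h' : (k + r + 2) • d' = drift r β k d g h - (2 * β * (k + r)) • e) :
    (k + r + 2) ^ 2 * ‖d'‖ ^ 2 ≤ k * (k + 2 * r) * ‖d‖ ^ 2 + β ^ 2 * r * (2 * k + 4 * r) * ‖h‖ ^ 2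
      - inner ℝ e ((4 * β * (k + r)) • drift r β k d g h)
      + 4 * β ^ 2 * (k + r) ^ 2 * ‖e‖ ^ 2 := by
  set c := d - (2 * β) • (h - g) with hc
  have hD : drift r β k d g h = k • c - (2 * β * r) • h := by rw [drift, hc]; module
  have h1 : (k + r + 2) ^ 2 * ‖d'‖ ^ 2 = ‖drift r β k d g h‖ ^ 2
      - inner ℝ e ((4 * β * (k + r)) • drift r β k d g h) + 4 * β ^ 2 * (k + r) ^ 2 * ‖e‖ ^ 2 := by
    have : (k + r + 2) ^ 2 * ‖d'‖ ^ 2 = ‖(k + r + 2) • d'‖ ^ 2 := by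
      rw [norm_smul, mul_pow, Real.norm_eq_abs, sq_abs]
    rw [this, h', norm_sub_sq_real, norm_smul, mul_pow, Real.norm_eq_abs, sq_abs,
      real_inner_smul_right, real_inner_smul_right, real_inner_comm e]
    ring
  have h2 : ‖c‖ ^ 2 ≤ ‖d‖ ^ 2 := by
    rw [hc, norm_sub_sq_real, norm_smul, mul_pow, Real.norm_eq_abs, sq_abs,
      real_inner_smul_right, real_inner_comm]
    nlinarith
  -- Young's inequality for the cross term, with the dropped square kept explicit.
  have h3 : ‖drift r β k d g h‖ ^ 2 = k * (k + 2 * r) * ‖c‖ ^ 2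
      + β ^ 2 * r * (2 * k + 4 * r) * ‖h‖ ^ 2 - k * (2 * r) * ‖c + β • h‖ ^ 2 := by
    rw [hD, norm_sub_sq_real, norm_add_sq_real]
    simp only [norm_smul, mul_pow, Real.norm_eq_abs, sq_abs, real_inner_smul_right,
      real_inner_smul_left]
    ring
  have h4 : 0 ≤ k * (2 * r) * ‖c + β • h‖ ^ 2 := by positivity
  have h5 : k * (k + 2 * r) * ‖c‖ ^ 2 ≤ k * (k + 2 * r) * ‖d‖ ^ 2 :=
    mul_le_mul_of_nonneg_left h2 (by positivity)
  linarith

/-- The direction against which the noise acts in `velocity_step`. -/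
noncomputable def velocityDir (r β k : ℝ) (d g h : E) : E :=
  (4 * β * (k + r) ^ 2 / (k + r + 2)) •
      (k • (d + (2 * β) • g) - (2 / (k + r + 2)) • drift r β k d g h)
    - (16 * β * (k + r) ^ 2 / (r * (k + r + 2) ^ 2)) • drift r β k d g h

/-- With `v = d + 2βg` and the noiseless increment `w = drift / (k + r + 2)`, the scaled new
velocity is `k v - 2 w` up to noise. Exchanging `w` for `d'` at the end creates one more noise
product, which accounts for the second term of `velocityDir`. -/
lemma velocity_step (hk : 0 ≤ k) (hr : 0 < r)
    (h' : (k + r + 2) • d' = drift r β k d g h - (2 * β * (k + r)) • e) :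
    (k + r) ^ 2 * ‖d' + (2 * β) • h‖ ^ 2 ≤ k * (k + r) * ‖d + (2 * β) • g‖ ^ 2
      + 4 * (k + r) / r * ‖d'‖ ^ 2 - inner ℝ e (velocityDir r β k d g h)
      + 4 * β ^ 2 * (k + r) ^ 2 * ‖e‖ ^ 2 := by
  have ht : 0 < k + r + 2 := by linarith
  set t := k + r + 2 with htdef
  set v := d + (2 * β) • g with hv
  set D := drift r β k d g h with hD
  set w := (1 / t) • D with hw
  have hDw : D = t • w := by rw [hw, smul_smul, mul_one_div_cancel ht.ne', one_smul]
  set η := 2 * β * (k + r) / t with hη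
  have htη : t * η = 2 * β * (k + r) := by rw [hη]; field_simp
  have hd' : d' = w - η • e := by
    have : t • d' = t • (w - η • e) := by rw [h', hDw, ← htη]; module
    exact smul_right_injective E ht.ne' this
  set c := 2 * β * (k + r) ^ 2 / t with hc
  have hc' : 2 * β * (k + r) - 2 * η = c := by
    rw [hη, hc, htdef] at *; field_simp; ring
  have hv' : (k + r) • (d' + (2 * β) • h) = (k • v - (2 : ℝ) • w) - c • e := by
    have h1 : D = k • v - (2 * β * (k + r)) • h := by rw [hD, drift, hv]; module
    have h2 : (k + r) • (d' + (2 * β) • h)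
        = t • d' + (2 * β * (k + r)) • h - (2 : ℝ) • d' := by rw [htdef]; module
    rw [h2, h', h1, hd', ← hc']; module
  have hdir : velocityDir r β k d g h
      = (2 * c) • (k • v - (2 : ℝ) • w) - (8 * (k + r) * η / r) • w := by
    rw [velocityDir, ← htdef, ← hD, ← hv]
    congr 1
    · congr 1
      · rw [hc]; ring
      · rw [hDw, smul_smul, div_mul_cancel₀ _ ht.ne']
    · rw [hDw, smul_smul]
      congr 1
      rw [hη]; field_simp; ring
  have h1 : (k + r) ^ 2 * ‖d' + (2 * β) • h‖ ^ 2
      = ‖k • v - (2 : ℝ) • w‖ ^ 2 - 2 * c * inner ℝ e (k • v - (2 : ℝ) • w)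
        + c ^ 2 * ‖e‖ ^ 2 := by
    have : (k + r) ^ 2 * ‖d' + (2 * β) • h‖ ^ 2 = ‖(k + r) • (d' + (2 * β) • h)‖ ^ 2 := by
      rw [norm_smul, mul_pow, Real.norm_eq_abs, sq_abs]
    rw [this, hv', norm_sub_sq_real _ (c • e), norm_smul c, mul_pow, Real.norm_eq_abs, sq_abs,
      real_inner_smul_right, real_inner_comm e]
    ring
  -- The weights are chosen so that the cross term is completed to the square of `r v + 2 w`,
  -- dropped later.
  have h2 : ‖k • v - (2 : ℝ) • w‖ ^ 2 = k * (k + r) * ‖v‖ ^ 2 + 4 * (k + r) / r * ‖w‖ ^ 2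
      - k / r * ‖r • v + (2 : ℝ) • w‖ ^ 2 := by
    rw [norm_sub_sq_real, norm_add_sq_real (r • v)]
    simp only [norm_smul, mul_pow, Real.norm_eq_abs, sq_abs, real_inner_smul_right,
      real_inner_smul_left]
    field_simp
    ring
  have h3 : ‖d'‖ ^ 2 = ‖w‖ ^ 2 - 2 * η * inner ℝ e w + η ^ 2 * ‖e‖ ^ 2 := by
    rw [hd', norm_sub_sq_real w, norm_smul η, mul_pow, Real.norm_eq_abs, sq_abs,
      real_inner_smul_right, real_inner_comm]
    ring
  have h4 : inner ℝ e (velocityDir r β k d g h)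
      = 2 * c * inner ℝ e (k • v - (2 : ℝ) • w) - 8 * (k + r) * η / r * inner ℝ e w := by
    rw [hdir, inner_sub_right, real_inner_smul_right, real_inner_smul_right]
  have h5 : c ^ 2 ≤ 4 * β ^ 2 * (k + r) ^ 2 := by
    have : c = 2 * β * (k + r) * ((k + r) / t) := by rw [hc]; ring
    have hle : (k + r) / t ≤ 1 := (div_le_one ht).2 (by linarith)
    have h0 : 0 ≤ (k + r) / t := by positivity
    rw [this, mul_pow]
    have : ((k + r) / t) ^ 2 ≤ 1 := pow_le_one₀ h0 hle
    nlinarith [sq_nonneg (2 * β * (k + r))]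
  have h6 : 0 ≤ k / r * ‖r • v + (2 : ℝ) • w‖ ^ 2 := by positivity
  have h7 : 0 ≤ 4 * (k + r) / r * (η ^ 2 * ‖e‖ ^ 2) := by positivity
  have h8 := mul_le_mul_of_nonneg_right h5 (sq_nonneg ‖e‖)
  rw [h1, h2, h3, h4]
  have h9 : 4 * (k + r) / r * (‖w‖ ^ 2 - 2 * η * inner ℝ e w + η ^ 2 * ‖e‖ ^ 2)
      = 4 * (k + r) / r * ‖w‖ ^ 2 - 8 * (k + r) * η / r * inner ℝ e w
        + 4 * (k + r) / r * (η ^ 2 * ‖e‖ ^ 2) := by ring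
  rw [h9]
  linarith

lemma residual_le (d' h : E) (β : ℝ) :
    4 * β ^ 2 * ‖h‖ ^ 2 ≤ 2 * ‖d' + (2 * β) • h‖ ^ 2 + 2 * ‖d'‖ ^ 2 := by
  have h1 : 4 * β ^ 2 * ‖h‖ ^ 2 = ‖(d' + (2 * β) • h) - d'‖ ^ 2 := by
    rw [add_sub_cancel_left, norm_smul, mul_pow, Real.norm_eq_abs, sq_abs]; ring
  have h2 := parallelogram_law_with_norm ℝ (d' + (2 * β) • h) d'
  rw [h1]
  nlinarith [sq_nonneg ‖(d' + (2 * β) • h) + d'‖]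

end OneStep

/-! ### Real sequences -/

section Sequences

/-- Subtracting the partial sums of `Z` leaves a decreasing sequence bounded below. `Z` may change
sign and need only have convergent partial sums, which is what a convergent martingale provides. -/
lemma exists_tendsto_of_le_add {X Z : ℕ → ℝ} {c : ℝ} (hX : ∀ k, 0 ≤ X k)
    (hZ : Tendsto (fun N => ∑ k ∈ Finset.range N, Z k) atTop (𝓝 c))
    (h : ∀ k, X (k + 1) ≤ X k + Z k) : ∃ l, Tendsto X atTop (𝓝 l) := by
  set f : ℕ → ℝ := fun N => X N - ∑ k ∈ Finset.range N, Z k with hf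
  have hanti : Antitone f := antitone_nat_of_succ_le fun k => by
    simp only [hf, Finset.sum_range_succ]
    linarith [h k]
  obtain ⟨M, hM⟩ := hZ.bddAbove_range
  have hbdd : BddBelow (Set.range f) := ⟨-M, by
    rintro _ ⟨N, rfl⟩
    have : ∑ k ∈ Finset.range N, Z k ≤ M := hM ⟨N, rfl⟩
    simp only [hf]
    linarith [hX N]⟩
  refine ⟨_, ((tendsto_atTop_ciInf hanti hbdd).add hZ).congr fun N => ?_⟩
  simp [hf]

/-- A positive limit would make the series dominate a multiple of the harmonic series. -/
lemma tendsto_zero_of_summable_div {w : ℕ → ℝ} {l c : ℝ} (hc : 0 < c) (hw : ∀ k, 0 ≤ w k)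
    (hl : Tendsto w atTop (𝓝 l)) (hs : Summable fun k : ℕ => w k / (k + c)) :
    Tendsto w atTop (𝓝 0) := by
  have hl0 : 0 ≤ l := ge_of_tendsto' hl hw
  rcases hl0.eq_or_lt with rfl | hpos
  · exact hl
  exfalso
  have hev : ∀ᶠ k : ℕ in atTop, ‖(1 : ℝ) / k‖ ≤ 4 / l * (w k / (k + c)) := by
    filter_upwards [hl.eventually (lt_mem_nhds (half_lt_self hpos)),
      tendsto_natCast_atTop_atTop.eventually (eventually_ge_atTop (max c 1))] with k hk hkc
    have h1 : c ≤ k := (le_max_left _ _).trans hkc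
    have h2 : (1 : ℝ) ≤ k := (le_max_right _ _).trans hkc
    have hk0 : (0 : ℝ) < k := by linarith
    rw [Real.norm_of_nonneg (by positivity), div_mul_div_comm, div_le_div_iff₀ hk0 (by positivity)]
    nlinarith [mul_pos hpos hk0, mul_pos (sub_pos.2 hk) hk0]
  exact Real.not_summable_one_div_natCast
    (Summable.of_norm_bounded_eventually_nat (hs.mul_left _) hev)

/-- Noise accumulated along the variance recursion. -/
lemma mul_sum_noise_le {D W : ℕ → ℝ} {ρ Θ Θhat : ℝ} (hρ1 : ρ ≤ 1) (hΘhat : 0 ≤ Θhat)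
    (hD : ∀ k, 0 ≤ D k) (hW : ∀ k, 0 ≤ W k) (hD0 : D 0 = 0) (hW0 : W 0 = 0)
    (hrec : ∀ k, D (k + 1) ≤ (1 - ρ) * D k + Θ * W (k + 1) + Θhat * W k) (N : ℕ) :
    ρ * ∑ k ∈ Finset.range N, D k ≤ (Θ + Θhat) * ∑ k ∈ Finset.range N, W k := by
  cases N with
  | zero => simp
  | succ N =>
    -- Keeping the last term `(1 - ρ) D N`, and one term fewer in the `Θhat` sum, makes the
    -- induction close.
    have key : ρ * ∑ k ∈ Finset.range (N + 1), D k + (1 - ρ) * D N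
        ≤ Θ * ∑ k ∈ Finset.range (N + 1), W k + Θhat * ∑ k ∈ Finset.range N, W k := by
      induction N with
      | zero => simp [hD0, hW0]
      | succ N ih =>
        rw [Finset.sum_range_succ D, Finset.sum_range_succ W (N + 1)]
        rw [Finset.sum_range_succ W N] at ih ⊢
        linarith [hrec N]
    rw [Finset.sum_range_succ W] at key ⊢
    have h1 := mul_nonneg (sub_nonneg.2 hρ1) (hD N)
    have h2 := mul_nonneg hΘhat (hW N)
    linarith

/-! ### Arithmetic of the constants and summation of the recursions. -/

section Constants

variable {L r β ρ Θs : ℝ} (hL : 0 < L) (hr : 2 < r) (hβ : 0 < β) (hρ : 0 < ρ) (hΘs : 0 ≤ Θs)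
  (hβ' : β < betaBar L r ρ Θs)
include hL hr hβ hρ hΘs hβ'

omit hβ in
lemma beta_mul_lt : β * ((ρ + (r + 1) * Θs) * L) < ρ := by
  have h : 0 < (ρ + (r + 1) * Θs) * L := by
    have := mul_nonneg (by linarith : 0 ≤ r + 1) hΘs
    exact mul_pos (by linarith) hL
  exact (lt_div_iff₀ h).1 hβ'

lemma beta_mul_L_lt_one : β * L < 1 := by
  have h := beta_mul_lt hL hr hρ hΘs hβ'
  have := mul_nonneg (mul_nonneg (by linarith : 0 ≤ r + 1) hΘs) (mul_pos hβ hL).le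
  by_contra hc
  nlinarith

lemma beta_le_inv : β ≤ 1 / L := by
  rw [le_div_iff₀ hL]
  exact (beta_mul_L_lt_one hL hr hβ hρ hΘs hβ').le

lemma Lam_pos : 0 < Lam L r β ρ Θs := by
  have h := beta_mul_lt hL hr hρ hΘs hβ'
  refine div_pos (mul_pos (by positivity) (by linarith)) ?_
  have : 0 < r + 1 := by linarith
  positivity

lemma psi_nonneg : 0 ≤ psi L r β ρ Θs := by
  have := Lam_pos hL hr hβ hρ hΘs hβ'
  unfold psi
  positivity

-- The Lyapunov argument produces the factor `r(r+1)`; `C0` enters through this comparison, whose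
-- spare factor 2 is spent in `velocity_bounds`.
omit hL hβ hρ hΘs hβ' in
lemma C0_ge : 2 * (r * (r + 1)) ≤ C0 L r β := by
  have : 0 ≤ r * (8 * r * L ^ 2 * β ^ 2) := by positivity
  unfold C0
  nlinarith

omit hρ hΘs hβ' in
lemma C1_ge : (2 / r + psi L r β ρ Θs) * C0 L r β ≤ C1 L r β ρ Θs := by
  have : 0 < r - 1 := by linarith
  have : 0 ≤ 4 * r ^ 2 * (r - 1) * L ^ 2 * β ^ 2 / (r + 2) := by positivity
  unfold C1
  linarith

lemma C1_nonneg : 0 ≤ C1 L r β ρ Θs := by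
  have h1 := psi_nonneg hL hr hβ hρ hΘs hβ'
  have h2 := C0_ge (L := L) (β := β) hr
  refine le_trans ?_ (C1_ge (ρ := ρ) (Θs := Θs) hL hr hβ)
  have : 0 ≤ C0 L r β := le_trans (by positivity) h2
  positivity

omit hρ hΘs hβ' in
lemma C2_ge : psi L r β ρ Θs * C0 L r β
    + 2 * (r + 2) ^ 2 / r * (C0 L r β + 2 * C1 L r β ρ Θs / (r - 2)) ≤ C2 L r β ρ Θs := by
  have h : 0 ≤ 4 * r ^ 2 * L ^ 2 * β ^ 2 := by positivity
  have hr' : r - 2 ≠ 0 := by linarith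
  have e : C2 L r β ρ Θs = 4 * r ^ 2 * L ^ 2 * β ^ 2 + (psi L r β ρ Θs * C0 L r β
    + 2 * (r + 2) ^ 2 / r * (C0 L r β + 2 * C1 L r β ρ Θs / (r - 2))) := by
    unfold C2
    field_simp
    ring
  linarith

lemma C2_nonneg : 0 ≤ C2 L r β ρ Θs := by
  have h1 := psi_nonneg hL hr hβ hρ hΘs hβ'
  have h2 := C0_ge (L := L) (β := β) hr
  have h3 := C1_nonneg hL hr hβ hρ hΘs hβ'
  refine le_trans ?_ (C2_ge (ρ := ρ) (Θs := Θs) hL hr hβ)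
  have : 0 ≤ C0 L r β := le_trans (by positivity) h2
  have : 0 < r - 2 := by linarith
  positivity

/-- Summation of the Lyapunov inequality. -/
lemma sum_energy_le {A q U D W : ℕ → ℝ} (hA : ∀ k, 0 ≤ A k) (hU : ∀ k, 0 ≤ U k) (hU0 : U 0 = 0)
    (hW : ∀ k : ℕ, W k = (k + r) ^ 2 * U k)
    (hnoise : ∀ N, ρ * ∑ k ∈ Finset.range N, D k ≤ Θs * ∑ k ∈ Finset.range N, W k)
    (hstep : ∀ k : ℕ, A (k + 1) + (2 * k + r + 3) * q k + 4 * β * k * (k + r) * (1 / L - β) * U k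
      ≤ A k + 4 * β ^ 2 * D k) (N : ℕ) :
    ∑ k ∈ Finset.range N, (2 * (k : ℝ) + r + 3) * q k
      + Lam L r β ρ Θs * ∑ k ∈ Finset.range N, W k ≤ A 0 := by
  -- `Lam + 4β²Θs/ρ` equals `4β(1/L - β)/(r+1)`, and `k + r ≤ (r+1) k` for `k ≥ 1` converts the
  -- weight `k(k+r)` into `(k+r)²`. At `k = 0` the variation vanishes.
  have hdom : ∀ k : ℕ, Lam L r β ρ Θs * W k + 4 * β ^ 2 / ρ * (Θs * W k)
      ≤ 4 * β * k * (k + r) * (1 / L - β) * U k := by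
    intro k
    rcases Nat.eq_zero_or_pos k with rfl | hk
    · simp [hW, hU0]
    have hk1 : (1 : ℝ) ≤ k := by exact_mod_cast hk
    have h1 : (k : ℝ) + r ≤ (r + 1) * k := by nlinarith
    have hkr : 0 < (k : ℝ) + r := by linarith
    have hr1 : 0 < r + 1 := by linarith
    have e : 4 * β * k * (k + r) * (1 / L - β) * U k - (Lam L r β ρ Θs * W k
        + 4 * β ^ 2 / ρ * (Θs * W k))
        = (Lam L r β ρ Θs + 4 * β ^ 2 * Θs / ρ) * ((r + 1) * k - (k + r)) * ((k + r) * U k) := by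
      rw [hW]
      unfold Lam
      field_simp
      ring
    have : 0 ≤ (Lam L r β ρ Θs + 4 * β ^ 2 * Θs / ρ) * ((r + 1) * k - (k + r))
        * ((k + r) * U k) := by
      have := Lam_pos hL hr hβ hρ hΘs hβ'
      refine mul_nonneg (mul_nonneg (by positivity) (by linarith)) (mul_nonneg hkr.le (hU k))
    linarith
  have hsum : ∀ N, A N + ∑ k ∈ Finset.range N, (2 * (k : ℝ) + r + 3) * q k
      + (Lam L r β ρ Θs + 4 * β ^ 2 / ρ * Θs) * ∑ k ∈ Finset.range N, W k
      ≤ A 0 + 4 * β ^ 2 * ∑ k ∈ Finset.range N, D k := by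
    intro N
    induction N with
    | zero => simp
    | succ N ih =>
      simp only [Finset.sum_range_succ]
      linarith [hstep N, hdom N]
  have h1 := hsum N
  have h2 := mul_le_mul_of_nonneg_left (hnoise N) (by positivity : 0 ≤ 4 * β ^ 2 / ρ)
  have h3 : 4 * β ^ 2 / ρ * (ρ * ∑ k ∈ Finset.range N, D k)
      = 4 * β ^ 2 * ∑ k ∈ Finset.range N, D k := by field_simp
  linarith [hA N]

omit hL hr hβ hβ' in
lemma sum_noise_le_psi {D W : ℕ → ℝ} {K : ℝ} (hΛ : 0 < Lam L r β ρ Θs)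
    (hnoise : ∀ N, ρ * ∑ k ∈ Finset.range N, D k ≤ Θs * ∑ k ∈ Finset.range N, W k)
    (hW : ∀ N, Lam L r β ρ Θs * ∑ k ∈ Finset.range N, W k ≤ K) (N : ℕ) :
    4 * β ^ 2 * ∑ k ∈ Finset.range N, D k ≤ psi L r β ρ Θs * K := by
  have h2 := mul_le_mul_of_nonneg_left (hnoise N) (by positivity : 0 ≤ 4 * β ^ 2 / ρ)
  have h3 : 4 * β ^ 2 / ρ * (ρ * ∑ k ∈ Finset.range N, D k)
      = 4 * β ^ 2 * ∑ k ∈ Finset.range N, D k := by field_simp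
  have h4 := mul_le_mul_of_nonneg_left (hW N) (by unfold psi; positivity : 0 ≤ psi L r β ρ Θs)
  have h5 : psi L r β ρ Θs * (Lam L r β ρ Θs * ∑ k ∈ Finset.range N, W k)
      = 4 * β ^ 2 / ρ * (Θs * ∑ k ∈ Finset.range N, W k) := by
    unfold psi
    field_simp
  linarith

/-- Bounds for the sequence `V k = E ‖d_k + 2 β h_{k-1}‖²`. -/
lemma velocity_bounds {V q D : ℕ → ℝ} {R : ℝ} (hR : 0 ≤ R) (hV : ∀ k, 0 ≤ V k)
    (hq : ∀ k, 0 ≤ q k)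
    (hsq : ∀ N, ∑ k ∈ Finset.range N, (2 * (k : ℝ) + r + 3) * q k ≤ r * (r + 1) * R)
    (hsD : ∀ N, 4 * β ^ 2 * ∑ k ∈ Finset.range N, D k ≤ psi L r β ρ Θs * (r * (r + 1) * R))
    (hstep : ∀ k : ℕ, (k + r) ^ 2 * V (k + 1)
      ≤ k * (k + r) * V k + 4 * (k + r) / r * q k + 4 * β ^ 2 * D k) (N : ℕ) :
    (N + r) ^ 2 * V (N + 1) ≤ C1 L r β ρ Θs * R ∧
    ∑ k ∈ Finset.range N, (2 * (k : ℝ) + r + 3) * V (k + 1)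
      ≤ 2 * C1 L r β ρ Θs / (r - 2) * R := by
  have hr0 : 0 < r - 2 := by linarith
  -- The surplus at each index is `(k+r)² - (k+1)(k+1+r) = (r-2)(k+1) + (r-1)²`, growing linearly
  -- because `r > 2`.
  have htel : (N + r) ^ 2 * V (N + 1)
      + ∑ k ∈ Finset.range N, ((r - 2) * ((k : ℝ) + 1) + (r - 1) ^ 2) * V (k + 1)
      ≤ ∑ k ∈ Finset.range (N + 1), (4 * (k + r) / r * q k + 4 * β ^ 2 * D k) := by
    induction N with
    | zero => simpa using hstep 0
    | succ N ih =>
      rw [Finset.sum_range_succ, Finset.sum_range_succ _ (N + 1)]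
      have := hstep (N + 1)
      push_cast at this ⊢
      linarith
  have hs : ∑ k ∈ Finset.range (N + 1), (4 * (k + r) / r * q k + 4 * β ^ 2 * D k)
      ≤ C1 L r β ρ Θs * R := by
    have h1 : ∑ k ∈ Finset.range (N + 1), 4 * (k + r) / r * q k
        ≤ 4 / r * ∑ k ∈ Finset.range (N + 1), (2 * (k : ℝ) + r + 3) * q k := by
      rw [Finset.mul_sum]
      refine Finset.sum_le_sum fun k _ => ?_
      have : 4 * (k + r) / r * q k = 4 / r * ((k + r) * q k) := by ring
      rw [this]
      refine mul_le_mul_of_nonneg_left (mul_le_mul_of_nonneg_right ?_ (hq k)) (by positivity)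
      have : (0 : ℝ) ≤ k := k.cast_nonneg
      linarith
    rw [Finset.sum_add_distrib, ← Finset.mul_sum]
    have h2 := mul_le_mul_of_nonneg_left (hsq (N + 1)) (by positivity : 0 ≤ 4 / r)
    have h3 := mul_le_mul_of_nonneg_right (C1_ge (ρ := ρ) (Θs := Θs) hL hr hβ) hR
    have h4 := C0_ge (L := L) (β := β) hr
    have h5 := mul_le_mul_of_nonneg_left (mul_le_mul_of_nonneg_right h4 hR)
      (by positivity : 0 ≤ 2 / r)
    have h6 := mul_le_mul_of_nonneg_left (mul_le_mul_of_nonneg_right h4 hR)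
      (psi_nonneg hL hr hβ hρ hΘs hβ')
    have h7 : 0 ≤ psi L r β ρ Θs * (r * (r + 1) * R) := by
      have := psi_nonneg hL hr hβ hρ hΘs hβ'
      positivity
    have e : 4 / r * (r * (r + 1) * R) = 2 / r * (2 * (r * (r + 1)) * R) := by ring
    linarith [hsD (N + 1)]
  have hsn : 0 ≤ ∑ k ∈ Finset.range N, ((r - 2) * ((k : ℝ) + 1) + (r - 1) ^ 2) * V (k + 1) :=
    Finset.sum_nonneg fun k _ => mul_nonneg (by positivity) (hV _)
  have hfn : 0 ≤ (N + r) ^ 2 * V (N + 1) := mul_nonneg (sq_nonneg _) (hV _)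
  refine ⟨by linarith, ?_⟩
  have h1 : ∑ k ∈ Finset.range N, (2 * (k : ℝ) + r + 3) * V (k + 1)
      ≤ 2 / (r - 2) * ∑ k ∈ Finset.range N, ((r - 2) * ((k : ℝ) + 1) + (r - 1) ^ 2) * V (k + 1) := by
    rw [Finset.mul_sum]
    refine Finset.sum_le_sum fun k _ => ?_
    rw [← mul_assoc]
    refine mul_le_mul_of_nonneg_right ?_ (hV _)
    rw [div_mul_eq_mul_div, le_div_iff₀ hr0]
    -- The difference of the two sides is `r² - 3r + 4`.
    nlinarith [sq_nonneg (r - 3 / 2)]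
  have h2 : 2 * C1 L r β ρ Θs / (r - 2) * R = 2 / (r - 2) * (C1 L r β ρ Θs * R) := by ring
  rw [h2]
  exact h1.trans (mul_le_mul_of_nonneg_left (by linarith) (by positivity))

/-- Bounds for the sequence `H k = E ‖h_k‖²`. -/
lemma residual_sum_bound {V q H : ℕ → ℝ} {R : ℝ} (hR : 0 ≤ R)
    (hsq : ∀ N, ∑ k ∈ Finset.range N, (2 * (k : ℝ) + r + 3) * q k ≤ r * (r + 1) * R)
    (hsV : ∀ N, ∑ k ∈ Finset.range N, (2 * (k : ℝ) + r + 3) * V (k + 1)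
      ≤ 2 * C1 L r β ρ Θs / (r - 2) * R)
    (hH : ∀ k, 4 * β ^ 2 * H k ≤ 2 * V (k + 1) + 2 * q k) (N : ℕ) :
    ∑ k ∈ Finset.range N, (2 * (k : ℝ) + r + 3) * H k
      ≤ (r + 2) ^ 2 / (2 * β ^ 2 * r ^ 2) * (C0 L r β + 2 * C1 L r β ρ Θs / (r - 2)) * R := by
  have h0 : ∑ k ∈ Finset.range N, (2 * (k : ℝ) + r + 3) * H k
      ≤ 1 / (2 * β ^ 2) * (∑ k ∈ Finset.range N, (2 * (k : ℝ) + r + 3) * V (k + 1)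
        + ∑ k ∈ Finset.range N, (2 * (k : ℝ) + r + 3) * q k) := by
    rw [← Finset.sum_add_distrib, Finset.mul_sum]
    refine Finset.sum_le_sum fun k _ => ?_
    have h1 : H k ≤ 1 / (2 * β ^ 2) * (V (k + 1) + q k) := by
      rw [one_div_mul_eq_div, le_div_iff₀ (by positivity)]
      linarith [hH k]
    have h2 : 0 ≤ 2 * (k : ℝ) + r + 3 := by positivity
    calc _ ≤ (2 * (k : ℝ) + r + 3) * (1 / (2 * β ^ 2) * (V (k + 1) + q k)) :=
          mul_le_mul_of_nonneg_left h1 h2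
      _ = _ := by ring
  have h1 : r * (r + 1) * R ≤ C0 L r β * R := by
    refine mul_le_mul_of_nonneg_right ?_ hR
    have := C0_ge (L := L) (β := β) hr
    have : 0 ≤ r * (r + 1) := by positivity
    linarith
  set c := C0 L r β + 2 * C1 L r β ρ Θs / (r - 2) with hc
  have hcn : 0 ≤ c * R := by
    have h2 := C0_ge (L := L) (β := β) hr
    have h3 := C1_nonneg hL hr hβ hρ hΘs hβ'
    have : 0 ≤ C0 L r β := le_trans (by positivity) h2
    have : 0 < r - 2 := by linarith
    positivity
  have h3 : 1 / (2 * β ^ 2) ≤ (r + 2) ^ 2 / (2 * β ^ 2 * r ^ 2) := by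
    rw [div_le_div_iff₀ (by positivity) (by positivity)]
    nlinarith [sq_nonneg β, mul_nonneg (sq_nonneg β) (by linarith : 0 ≤ r)]
  calc _ ≤ 1 / (2 * β ^ 2) * (c * R) := h0.trans (mul_le_mul_of_nonneg_left (by
        rw [hc, add_mul]; linarith [hsq N, hsV N]) (by positivity))
    _ ≤ (r + 2) ^ 2 / (2 * β ^ 2 * r ^ 2) * (c * R) := mul_le_mul_of_nonneg_right h3 hcn
    _ = _ := by ring

/-- Bounds for the sequence `d k = E ‖x^k - x^{k-1}‖²`. -/
lemma increment_bound {d H D : ℕ → ℝ} {R : ℝ} (hR : 0 ≤ R) (hd : ∀ k, 0 ≤ d k) (hd0 : d 0 = 0)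
    (hH : ∀ k, 0 ≤ H k)
    (hsH : ∀ N, ∑ k ∈ Finset.range N, (2 * (k : ℝ) + r + 3) * H k
      ≤ (r + 2) ^ 2 / (2 * β ^ 2 * r ^ 2) * (C0 L r β + 2 * C1 L r β ρ Θs / (r - 2)) * R)
    (hsD : ∀ N, 4 * β ^ 2 * ∑ k ∈ Finset.range N, D k ≤ psi L r β ρ Θs * (r * (r + 1) * R))
    (hstep : ∀ k : ℕ, (k + r + 2) ^ 2 * d (k + 1)
      ≤ k * (k + 2 * r) * d k + β ^ 2 * r * (2 * k + 4 * r) * H k + 4 * β ^ 2 * D k) (N : ℕ) :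
    (N + r + 2) ^ 2 * d (N + 1) ≤ C2 L r β ρ Θs * R := by
  -- Since `N(N + 2r) ≤ (N + r + 1)²`, the weighted increments telescope.
  have htel : ∀ N : ℕ, (N + r + 1) ^ 2 * d N
      ≤ ∑ k ∈ Finset.range N, (β ^ 2 * r * (2 * k + 4 * r) * H k + 4 * β ^ 2 * D k) := by
    intro N
    induction N with
    | zero => simp [hd0]
    | succ N ih =>
      rw [Finset.sum_range_succ]
      have h1 : (N : ℝ) * (N + 2 * r) * d N ≤ (N + r + 1) ^ 2 * d N := by
        refine mul_le_mul_of_nonneg_right ?_ (hd N)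
        nlinarith [N.cast_nonneg (α := ℝ)]
      have e : ((N + 1 : ℕ) : ℝ) + r + 1 = N + r + 2 := by push_cast; ring
      rw [e]
      linarith [hstep N]
  have h1 := htel (N + 1)
  have e : ((N + 1 : ℕ) : ℝ) + r + 1 = N + r + 2 := by push_cast; ring
  rw [e] at h1
  refine h1.trans ?_
  rw [Finset.sum_add_distrib, ← Finset.mul_sum]
  set c := C0 L r β + 2 * C1 L r β ρ Θs / (r - 2) with hc
  have h2 : ∑ k ∈ Finset.range (N + 1), β ^ 2 * r * (2 * k + 4 * r) * H k
      ≤ 4 * (β ^ 2 * r) * ∑ k ∈ Finset.range (N + 1), (2 * (k : ℝ) + r + 3) * H k := by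
    rw [Finset.mul_sum]
    refine Finset.sum_le_sum fun k _ => ?_
    rw [← mul_assoc]
    refine mul_le_mul_of_nonneg_right ?_ (hH k)
    have h0 : (0 : ℝ) ≤ k := k.cast_nonneg
    have : 0 ≤ β ^ 2 * r := by positivity
    nlinarith
  have h3 := mul_le_mul_of_nonneg_left (hsH (N + 1)) (by positivity : 0 ≤ 4 * (β ^ 2 * r))
  have h4 : 4 * (β ^ 2 * r) * ((r + 2) ^ 2 / (2 * β ^ 2 * r ^ 2) * c * R)
      = 2 * (r + 2) ^ 2 / r * c * R := by
    field_simp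
    ring
  have h5 := mul_le_mul_of_nonneg_right (C2_ge (ρ := ρ) (Θs := Θs) hL hr hβ) hR
  have h6 := C0_ge (L := L) (β := β) hr
  have h7 : r * (r + 1) ≤ C0 L r β := by
    have : 0 ≤ r * (r + 1) := by positivity
    linarith
  have h8 := mul_le_mul_of_nonneg_left (mul_le_mul_of_nonneg_right h7 hR)
    (psi_nonneg hL hr hβ hρ hΘs hβ')
  rw [← hc, add_mul] at h5
  linarith [hsD (N + 1)]

lemma residual_rate {V q H : ℕ → ℝ} {R : ℝ} (hR : 0 ≤ R) (N : ℕ)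
    (hV : (N + r) ^ 2 * V (N + 1) ≤ C1 L r β ρ Θs * R)
    (hq : (N + r + 2) ^ 2 * q N ≤ C2 L r β ρ Θs * R)
    (hH : 4 * β ^ 2 * H N ≤ 2 * V (N + 1) + 2 * q N) :
    H N ≤ C3 L r β ρ Θs * R / (β ^ 2 * ((N : ℝ) + r - 1) * ((N : ℝ) + r + 2)) := by
  set s : ℝ := N + r with hs
  have hs0 : r ≤ s := by have := N.cast_nonneg (α := ℝ); linarith
  have hsp : 0 < s := by linarith
  have hsp1 : 0 < s - 1 := by linarith
  have hC1 := mul_nonneg (C1_nonneg hL hr hβ hρ hΘs hβ') hR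
  have hC2 := mul_nonneg (C2_nonneg hL hr hβ hρ hΘs hβ') hR
  have h1 : V (N + 1) ≤ C1 L r β ρ Θs * R / s ^ 2 := by
    rw [le_div_iff₀ (by positivity)]; linarith
  have h2 : q N ≤ C2 L r β ρ Θs * R / s ^ 2 := by
    refine le_trans ?_ (div_le_div_of_nonneg_left hC2 (by positivity)
      (pow_le_pow_left₀ hsp.le (by linarith : s ≤ s + 2) 2))
    rw [le_div_iff₀ (by positivity)]; linarith
  have h3 : 2 * β ^ 2 * H N ≤ (C1 L r β ρ Θs + C2 L r β ρ Θs) * R / s ^ 2 := by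
    rw [add_mul, add_div]; linarith
  have hkey : (s - 1) * (s + 2) * r ^ 2 ≤ (r + 2) ^ 2 * s ^ 2 := by
    have h4 : s * r ^ 2 ≤ s ^ 2 * (4 * r) := by nlinarith [mul_nonneg hsp.le (sq_nonneg r)]
    nlinarith [sq_nonneg s, sq_nonneg r]
  rw [le_div_iff₀ (by positivity), C3]
  rw [le_div_iff₀ (by positivity)] at h3
  set K := (C1 L r β ρ Θs + C2 L r β ρ Θs) * R with hK
  have e : (r + 2) ^ 2 * (C1 L r β ρ Θs + C2 L r β ρ Θs) / (2 * r ^ 2) * R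
      = (r + 2) ^ 2 * K / (2 * r ^ 2) := by rw [hK]; ring
  rw [e, le_div_iff₀ (by positivity)]
  have hKn : 0 ≤ K := by rw [hK, add_mul]; linarith
  have h5 : 0 ≤ (s - 1) * (s + 2) * r ^ 2 := by positivity
  have h6 := mul_le_mul_of_nonneg_left h3 h5
  have h7 := mul_le_mul_of_nonneg_right hkey hKn
  have h8 : s ^ 2 * (H N * (β ^ 2 * (s - 1) * (s + 2)) * (2 * r ^ 2)) ≤ s ^ 2 * ((r + 2) ^ 2 * K) := by
    linarith
  exact le_of_mul_le_mul_left h8 (by positivity)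

lemma complexity_of_rate {Q R ε : ℝ} (hR : 0 ≤ R) (hε : 0 < ε) (k : ℕ)
    (hQ : Q ≤ C3 L r β ρ Θs * R / (β ^ 2 * ((k : ℝ) + r - 1) * ((k : ℝ) + r + 2)))
    (hk : (Real.sqrt (C3 L r β ρ Θs * R) / β) * (1 / ε) ≤ k) : Q ≤ ε ^ 2 := by
  have hk0 := k.cast_nonneg (α := ℝ)
  have hC : 0 ≤ C3 L r β ρ Θs * R := by
    have h1 := C1_nonneg hL hr hβ hρ hΘs hβ'
    have h2 := C2_nonneg hL hr hβ hρ hΘs hβ'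
    unfold C3
    positivity
  have h1 : Real.sqrt (C3 L r β ρ Θs * R) ≤ k * (β * ε) := by
    rw [div_mul_div_comm, mul_one, div_le_iff₀ (by positivity)] at hk
    exact hk
  have h2 : C3 L r β ρ Θs * R ≤ (k * (β * ε)) ^ 2 := by
    rw [← Real.sq_sqrt hC]
    exact pow_le_pow_left₀ (Real.sqrt_nonneg _) h1 2
  have hp1 : 0 < (k : ℝ) + r - 1 := by linarith
  have hp2 : 0 < (k : ℝ) + r + 2 := by linarith
  refine hQ.trans ((div_le_iff₀ (by positivity)).2 (h2.trans ?_))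
  have h3 : (k : ℝ) ^ 2 ≤ ((k : ℝ) + r - 1) * ((k : ℝ) + r + 2) := by nlinarith
  have := mul_le_mul_of_nonneg_left h3 (by positivity : 0 ≤ ε ^ 2 * β ^ 2)
  linarith

end Constants

end Sequences

/-! ### Stochastic sequences -/

section StochasticTools

variable {Ω : Type*} {mΩ : MeasurableSpace Ω} {P : Measure Ω}
  {E : Type*} [NormedAddCommGroup E] [InnerProductSpace ℝ E]

lemma integrable_inner_of_memLp {f g : Ω → E} (hf : MemLp f 2 P) (hg : MemLp g 2 P) :
    Integrable (fun ω => inner ℝ (f ω) (g ω)) P := by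
  refine (L2.integrable_inner (𝕜 := ℝ) (hf.toLp f) (hg.toLp g)).congr ?_
  filter_upwards [hf.coeFn_toLp, hg.coeFn_toLp] with ω h1 h2
  rw [h1, h2]

omit [InnerProductSpace ℝ E] in
lemma integrable_norm_sq {f : Ω → E} (hf : MemLp f 2 P) : Integrable (fun ω => ‖f ω‖ ^ 2) P :=
  hf.norm.integrable_sq

/-- By Tonelli the sum has finite expectation, hence is almost surely finite. -/
lemma ae_summable_of_summable_integral {f : ℕ → Ω → ℝ} (hf0 : ∀ k ω, 0 ≤ f k ω)
    (hf : ∀ k, Integrable (f k) P) (hs : Summable fun k => ∫ ω, f k ω ∂P) :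
    ∀ᵐ ω ∂P, Summable fun k => f k ω := by
  have h1 : ∫⁻ ω, ∑' k, ENNReal.ofReal (f k ω) ∂P ≠ ⊤ := by
    rw [lintegral_tsum fun k => (hf k).aemeasurable.ennreal_ofReal]
    have : ∀ k, ∫⁻ ω, ENNReal.ofReal (f k ω) ∂P = ENNReal.ofReal (∫ ω, f k ω ∂P) := fun k =>
      (ofReal_integral_eq_lintegral_ofReal (hf k) (ae_of_all _ (hf0 k))).symm
    simp_rw [this]
    exact hs.tsum_ofReal_ne_top
  filter_upwards [ae_lt_top' (AEMeasurable.tsum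
    fun k => (hf k).aemeasurable.ennreal_ofReal) h1] with ω hω
  have := ENNReal.summable_toReal hω.ne
  exact this.congr fun k => ENNReal.toReal_ofReal (hf0 k ω)

lemma SumBound.of_partial {r c : ℝ} (hr : 0 ≤ r) {Q : ℕ → Ω → ℝ} (hQ : ∀ k ω, 0 ≤ Q k ω)
    (hQi : ∀ k, Integrable (Q k) P)
    (h : ∀ N, ∑ k ∈ Finset.range N, (2 * (k : ℝ) + r + 3) * ∫ ω, Q k ω ∂P ≤ c) :
    SumBound P r c Q := by
  have h0 : ∀ k : ℕ, 0 ≤ (2 * (k : ℝ) + r + 3) * ∫ ω, Q k ω ∂P := fun k =>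
    mul_nonneg (by positivity) (integral_nonneg (hQ k))
  exact ⟨hQi, summable_of_sum_range_le h0 h, Real.tsum_le_of_sum_range_le h0 h⟩

lemma SumBound.ae_summable {r c : ℝ} (hr : 0 ≤ r) {Q : ℕ → Ω → ℝ} (hQ : ∀ k ω, 0 ≤ Q k ω)
    (h : SumBound P r c Q) : ∀ᵐ ω ∂P, Summable fun k : ℕ => (2 * (k : ℝ) + r + 3) * Q k ω := by
  refine ae_summable_of_summable_integral (fun k ω => mul_nonneg (by positivity) (hQ k ω))
    (fun k => (h.integrable k).const_mul _) ?_
  simp_rw [integral_const_mul]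
  exact h.summable

lemma SumBound.mono {r c : ℝ} (hr : 0 ≤ r) {Q Q' : ℕ → Ω → ℝ} (h : SumBound P r c Q)
    (hQ' : ∀ k, Integrable (Q' k) P) (h0 : ∀ k ω, 0 ≤ Q' k ω) (hle : ∀ k ω, Q' k ω ≤ Q k ω) :
    SumBound P r c Q' := by
  refine .of_partial hr h0 hQ' fun N => ?_
  refine le_trans (Finset.sum_le_sum fun k _ => ?_) (le_trans
    (h.summable.sum_le_tsum (Finset.range N) fun k _ => ?_) h.tsum_le)
  · exact mul_le_mul_of_nonneg_left (integral_mono (hQ' k) (h.integrable k) (hle k))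
      (by positivity)
  · exact mul_nonneg (by positivity) (integral_nonneg fun ω => (h0 k ω).trans (hle k ω))

lemma IncrementBounds.mono {L r β ρ Θs R : ℝ} (hr : 0 ≤ r) {Q Q' : ℕ → Ω → ℝ}
    (h : IncrementBounds P L r β ρ Θs R Q) (hQ' : ∀ k, Integrable (Q' k) P)
    (h0 : ∀ k ω, 0 ≤ Q' k ω) (hle : ∀ k ω, Q' k ω ≤ Q k ω) :
    IncrementBounds P L r β ρ Θs R Q' :=
  ⟨h.sum_bound.mono hr hQ' h0 hle, fun k =>
    (integral_mono (hQ' k) (h.sum_bound.integrable k) (hle k)).trans (h.rate k)⟩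

lemma ResidualBounds.mono {L r β ρ Θs R : ℝ} (hr : 0 ≤ r) {Q Q' : ℕ → Ω → ℝ}
    (h : ResidualBounds P L r β ρ Θs R Q) (hQ' : ∀ k, Integrable (Q' k) P)
    (h0 : ∀ k ω, 0 ≤ Q' k ω) (hle : ∀ k ω, Q' k ω ≤ Q k ω) :
    ResidualBounds P L r β ρ Θs R Q' :=
  ⟨h.sum_bound.mono hr hQ' h0 hle, fun k =>
    (integral_mono (hQ' k) (h.sum_bound.integrable k) (hle k)).trans (h.rate k),
    fun ε hε k hk => (integral_mono (hQ' k) (h.sum_bound.integrable k) (hle k)).trans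
      (h.complexity ε hε k hk)⟩

lemma SmallORates.mono {Q Q' : ℕ → Ω → ℝ} (h : SmallORates P Q) (hQ : ∀ k, Integrable (Q k) P)
    (hQ' : ∀ k, Integrable (Q' k) P) (h0 : ∀ k ω, 0 ≤ Q' k ω) (hle : ∀ k ω, Q' k ω ≤ Q k ω) :
    SmallORates P Q' := by
  constructor
  · exact squeeze_zero (fun k => mul_nonneg (sq_nonneg _) (integral_nonneg (h0 k)))
      (fun k => mul_le_mul_of_nonneg_left (integral_mono (hQ' k) (hQ k) (hle k)) (sq_nonneg _))
      h.expectation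
  · filter_upwards [h.almost_sure] with ω hω
    exact squeeze_zero (fun k => mul_nonneg (sq_nonneg _) (h0 k ω))
      (fun k => mul_le_mul_of_nonneg_left (hle k ω) (sq_nonneg _)) hω

/-! ### Martingale differences. -/

variable {ℱ : Filtration ℕ mΩ} [IsProbabilityMeasure P] [CompleteSpace E] {e m : ℕ → Ω → E}

lemma condExp_inner_eq_zero {m0 : MeasurableSpace Ω} {e m : Ω → E} (he : MemLp e 2 P)
    (hm : StronglyMeasurable[m0] m) (hm2 : MemLp m 2 P) (he0 : P[e | m0] =ᵐ[P] 0) :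
    P[fun ω => inner ℝ (e ω) (m ω) | m0] =ᵐ[P] 0 := by
  have h : P[fun ω => inner ℝ (e ω) (m ω) | m0] =ᵐ[P] fun ω => inner ℝ (P[e | m0] ω) (m ω) :=
    condExp_bilin_of_stronglyMeasurable_right (m := m0) (μ := P) (innerSL ℝ) hm
      (integrable_inner_of_memLp he hm2) (he.integrable one_le_two)
  filter_upwards [h, he0] with ω h1 h2
  simp [h1, h2]

lemma integral_inner_eq_zero {m0 : MeasurableSpace Ω} (hm0 : m0 ≤ mΩ) {e m : Ω → E}
    (he : MemLp e 2 P) (hm : StronglyMeasurable[m0] m) (hm2 : MemLp m 2 P)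
    (he0 : P[e | m0] =ᵐ[P] 0) : ∫ ω, inner ℝ (e ω) (m ω) ∂P = 0 := by
  rw [← integral_condExp hm0, integral_congr_ae (condExp_inner_eq_zero he hm hm2 he0)]
  simp

/-- Almost sure convergence of a nonnegative process that increases at most by summable terms and
martingale differences. -/
lemma ae_exists_tendsto_of_le_add {X Y : ℕ → Ω → ℝ}
    (he : ∀ k, StronglyMeasurable[ℱ (k + 1)] (e k)) (he2 : ∀ k, MemLp (e k) 2 P)
    (hm : ∀ k, StronglyMeasurable[ℱ k] (m k)) (hm2 : ∀ k, MemLp (m k) 2 P)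
    (he0 : ∀ k, P[e k | ℱ k] =ᵐ[P] 0) (hX : ∀ k ω, 0 ≤ X k ω) (hX0 : Integrable (X 0) P)
    (hY : ∀ k ω, 0 ≤ Y k ω) (hYi : ∀ k, Integrable (Y k) P)
    (hYs : Summable fun k => ∫ ω, Y k ω ∂P)
    (h : ∀ k ω, X (k + 1) ω ≤ X k ω + Y k ω - inner ℝ (e k ω) (m k ω)) :
    ∀ᵐ ω ∂P, ∃ l, Tendsto (fun k => X k ω) atTop (𝓝 l) := by
  -- The accumulated noise is a martingale, since `m k` is known at time `k` and `e k` is centred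
  -- given `ℱ k`.
  set M : ℕ → Ω → ℝ := fun N ω => ∑ k ∈ Finset.range N, inner ℝ (e k ω) (m k ω) with hM
  have hinner : ∀ k, Integrable (fun ω => inner ℝ (e k ω) (m k ω)) P := fun k =>
    integrable_inner_of_memLp (he2 k) (hm2 k)
  have hMint : ∀ N, Integrable (M N) P := fun N => integrable_finsetSum _ fun k _ => hinner k
  have hMart : Martingale M ℱ P := by
    refine martingale_of_condExp_sub_eq_zero_nat (fun N => ?_) hMint fun N => ?_
    · refine Finset.stronglyMeasurable_fun_sum _ fun k hk => ?_
      have hk : k + 1 ≤ N := Finset.mem_range.1 hk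
      exact ((he k).mono (ℱ.mono hk)).inner ((hm k).mono (ℱ.mono (by omega)))
    · have : M (N + 1) - M N = fun ω => inner ℝ (e N ω) (m N ω) := by
        ext ω
        simp [hM, Finset.sum_range_succ]
      rw [this]
      exact condExp_inner_eq_zero (he2 N) (hm N) (hm2 N) (he0 N)
  have hMzero : ∀ N, ∫ ω, M N ω ∂P = 0 := fun N => by
    rw [integral_finsetSum _ fun k _ => hinner k]
    exact Finset.sum_eq_zero fun k _ =>
      integral_inner_eq_zero (ℱ.le k) (he2 k) (hm k) (hm2 k) (he0 k)
  have hMX : ∀ N ω, X N ω + M N ω ≤ X 0 ω + ∑ k ∈ Finset.range N, Y k ω := by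
    intro N ω
    induction N with
    | zero => simp [hM]
    | succ N ih =>
      simp only [hM, Finset.sum_range_succ] at ih ⊢
      linarith [h N ω]
  set C := 2 * (∫ ω, X 0 ω ∂P + ∑' k, ∫ ω, Y k ω ∂P) with hC
  have hbdd : ∀ N, eLpNorm (M N) 1 P ≤ (Real.toNNReal C : NNReal) := by
    intro N
    have hBi : Integrable (fun ω => X 0 ω + ∑ k ∈ Finset.range N, Y k ω) P :=
      hX0.add (integrable_finsetSum _ fun k _ => hYi k)
    -- With `B = X 0 + ∑ Y`, nonnegativity of `X` gives `M ≤ B`, so `|M| ≤ 2B - M`. As `M` has mean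
    -- zero, this bounds it in `L¹`, and Doob's convergence theorem applies.
    have h1 : ∫ ω, ‖M N ω‖ ∂P ≤ C := by
      calc ∫ ω, ‖M N ω‖ ∂P
          ≤ ∫ ω, (2 * (X 0 ω + ∑ k ∈ Finset.range N, Y k ω) - M N ω) ∂P := by
            refine integral_mono (hMint N).norm ((hBi.const_mul 2).sub (hMint N)) fun ω => ?_
            have hle := hMX N ω
            have hXN := hX N ω
            have hB : 0 ≤ X 0 ω + ∑ k ∈ Finset.range N, Y k ω :=
              add_nonneg (hX 0 ω) (Finset.sum_nonneg fun k _ => hY k ω)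
            simp only [Real.norm_eq_abs]
            exact abs_le.2 ⟨by linarith, by linarith⟩ |>.trans le_rfl
        _ = 2 * (∫ ω, X 0 ω ∂P + ∑ k ∈ Finset.range N, ∫ ω, Y k ω ∂P) := by
            rw [integral_sub (hBi.const_mul 2) (hMint N), hMzero, integral_const_mul,
              integral_add hX0 (integrable_finsetSum _ fun k _ => hYi k),
              integral_finsetSum _ fun k _ => hYi k, sub_zero]
        _ ≤ C := by
            have := hYs.sum_le_tsum (Finset.range N) fun k _ => integral_nonneg (hY k)
            rw [hC]
            linarith
    rw [eLpNorm_one_eq_lintegral_enorm, ← ofReal_integral_norm_eq_lintegral_enorm (hMint N)]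
    exact ENNReal.ofReal_le_ofReal h1
  filter_upwards [hMart.submartingale.exists_ae_tendsto_of_bdd hbdd,
    ae_summable_of_summable_integral hY hYi hYs] with ω ⟨c, hc⟩ hYω
  refine exists_tendsto_of_le_add (Z := fun k => Y k ω - inner ℝ (e k ω) (m k ω))
    (hX · ω) (c := ∑' k, Y k ω - c) ?_ fun k => by linarith [h k ω]
  simp only [Finset.sum_sub_distrib]
  exact hYω.hasSum.tendsto_sum_nat.sub hc

end StochasticTools

/-! ### The fast Krasnoselskii–Mann method for co-coercive operators -/

section Cocoercive

variable {n p : ℕ} {L : ℝ} {H : Fin n → Vec p → Vec p}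

lemma IsCocoercive.norm_sub_le {F : Vec p → Vec p} (hL : 0 < L) (hF : IsCocoercive L F)
    (x y : Vec p) : ‖F x - F y‖ ≤ L * ‖x - y‖ := by
  have h1 := (hF x y).trans (real_inner_le_norm _ _)
  rw [one_div_mul_eq_div, div_le_iff₀ hL, sq] at h1
  rcases (norm_nonneg (F x - F y)).eq_or_lt with h | h
  · rw [← h]; positivity
  · exact le_of_mul_le_mul_left (by linarith) h

lemma norm_avg_sq_le (v : Fin n → Vec p) (hn : 0 < n) :
    ‖(1 / (n : ℝ)) • ∑ i, v i‖ ^ 2 ≤ (1 / (n : ℝ)) * ∑ i, ‖v i‖ ^ 2 := by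
  have hn' : (0 : ℝ) < n := by exact_mod_cast hn
  have h1 : ‖∑ i, v i‖ ^ 2 ≤ n * ∑ i, ‖v i‖ ^ 2 := by
    refine (pow_le_pow_left₀ (norm_nonneg _) (norm_sum_le _ _) 2).trans ?_
    simpa using sq_sum_le_card_mul_sum_sq (s := Finset.univ) (f := fun i => ‖v i‖)
  rw [norm_smul, mul_pow, Real.norm_of_nonneg (by positivity)]
  calc (1 / (n : ℝ)) ^ 2 * ‖∑ i, v i‖ ^ 2 ≤ (1 / (n : ℝ)) ^ 2 * (n * ∑ i, ‖v i‖ ^ 2) :=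
        mul_le_mul_of_nonneg_left h1 (by positivity)
    _ = _ := by field_simp

lemma avg_sub (x y : Vec p) : avg H x - avg H y = (1 / (n : ℝ)) • ∑ i, (H i x - H i y) := by
  rw [avg, avg, Finset.sum_sub_distrib, smul_sub]

variable (hH : ∀ i, IsCocoercive L (H i))
include hH

/-- Averaging the componentwise inequalities keeps the mean of the squares, as in `variation`, and
not merely the square of the mean; the variance recursion needs the former. -/
lemma mean_sq_le_inner (x y : Vec p) :
    1 / L * ((1 / (n : ℝ)) * ∑ i, ‖H i x - H i y‖ ^ 2) ≤ inner ℝ (avg H x - avg H y) (x - y) := by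
  rw [avg_sub, real_inner_smul_left, sum_inner, mul_left_comm, Finset.mul_sum _ _ (1 / L)]
  exact mul_le_mul_of_nonneg_left (Finset.sum_le_sum fun i _ => hH i x y) (by positivity)

lemma avg_cocoercive (hn : 0 < n) (hL : 0 < L) : IsCocoercive L (avg H) := fun x y => by
  refine le_trans (mul_le_mul_of_nonneg_left ?_ (by positivity)) (mean_sq_le_inner hH x y)
  rw [avg_sub]
  exact norm_avg_sq_le _ hn

end Cocoercive

/-- The stochastic fast Krasnoselskii–Mann iteration with a variance-reduced estimator. -/
structure IsFastKM {n p : ℕ} {Ω : Type*} {mΩ : MeasurableSpace Ω} (P : Measure Ω)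
    (ℱ : Filtration ℕ mΩ) (H : Fin n → Vec p → Vec p) (L r β ρ Θ Θhat : ℝ) (x0 : Vec p)
    (x S : ℕ → Ω → Vec p) (Δ : ℕ → Ω → ℝ) : Prop where
  n_pos : 0 < n
  L_pos : 0 < L
  cocoercive : ∀ i, IsCocoercive L (H i)
  two_lt : 2 < r
  beta_pos : 0 < β
  beta_lt : β < betaBar L r ρ (Θ + Θhat)
  init : ∀ ω, x 0 ω = x0
  S_zero : ∀ ω, S 0 ω = target H (gammaSeq r) x 0 ω
  step : ∀ k ω, x (k + 1) ω = x k ω + thetaSeq r k • (x k ω - x (k - 1) ω) - etaSeq r β k • S k ω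
  est : IsVREstimator P ℱ H (gammaSeq r) x S ρ Θ Θhat Δ
  Delta_zero : ∀ᵐ ω ∂P, Δ 0 ω = 0
  exists_zero : ∃ xs, avg H xs = 0

/-! ### Measurability, integrability and the noise recursion. -/

namespace IsFastKM

variable {n p : ℕ} {Ω : Type*} {mΩ : MeasurableSpace Ω} {P : Measure Ω}
  {ℱ : Filtration ℕ mΩ} {H : Fin n → Vec p → Vec p} {L r β ρ Θ Θhat : ℝ} {x0 : Vec p}
  {x S : ℕ → Ω → Vec p} {Δ : ℕ → Ω → ℝ}

/-- The estimation error. -/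
noncomputable def err (H : Fin n → Vec p → Vec p) (r : ℝ) (x S : ℕ → Ω → Vec p) (k : ℕ) (ω : Ω) : Vec p :=
  S k ω - target H (gammaSeq r) x k ω

/-- The increment `x^k - x^{k-1}`. -/
def inc (x : ℕ → Ω → Vec p) (k : ℕ) (ω : Ω) : Vec p := x k ω - x (k - 1) ω

/-- The velocity `x^k - x^{k-1} + 2 β H x^{k-1}`. -/
noncomputable def vel (H : Fin n → Vec p → Vec p) (β : ℝ) (x : ℕ → Ω → Vec p) (k : ℕ) (ω : Ω) : Vec p :=
  inc x k ω + (2 * β) • avg H (x (k - 1) ω)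

lemma x_succ (k : ℕ) (ω : Ω) : x (k + 1) ω = x k ω + inc x (k + 1) ω := by simp [inc]

variable (h : IsFastKM P ℱ H L r β ρ Θ Θhat x0 x S Δ)
include h

lemma r_pos : 0 < r := by linarith [h.two_lt]

lemma Theta_nonneg : 0 ≤ Θ + Θhat := by linarith [h.est.Theta_pos, h.est.Thetahat_nonneg]

lemma beta_le : β ≤ 1 / L :=
  beta_le_inv h.L_pos h.two_lt h.beta_pos h.est.rho_pos h.Theta_nonneg h.beta_lt

lemma continuous_comp (i : Fin n) : Continuous (H i) :=
  (LipschitzWith.of_dist_le_mul (K := L.toNNReal) fun x y => by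
    simpa [dist_eq_norm, h.L_pos.le] using (h.cocoercive i).norm_sub_le h.L_pos x y).continuous

lemma continuous_avg : Continuous (avg H) := by
  unfold avg
  have := h.continuous_comp
  fun_prop

lemma norm_avg_sub_le (y z : Vec p) : ‖avg H y - avg H z‖ ≤ L * ‖y - z‖ :=
  (avg_cocoercive h.cocoercive h.n_pos h.L_pos).norm_sub_le h.L_pos y z

lemma beta_mul_norm_sq_le (y z : Vec p) :
    β * ‖avg H y - avg H z‖ ^ 2 ≤ inner ℝ (avg H y - avg H z) (y - z) :=
  (mul_le_mul_of_nonneg_right h.beta_le (sq_nonneg _)).trans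
    (avg_cocoercive h.cocoercive h.n_pos h.L_pos y z)

/-- Multiplication by `k + r + 2` clears the denominators of `θ`, `η` and `η γ` together. -/
lemma step_inc (k : ℕ) (ω : Ω) : ((k : ℝ) + r + 2) • inc x (k + 1) ω
    = drift r β k (inc x k ω) (avg H (x (k - 1) ω)) (avg H (x k ω))
      - (2 * β * (k + r)) • err H r x S k ω := by
  have hr := h.r_pos
  have h1 : ((k : ℝ) + r + 2) * thetaSeq r k = k := by unfold thetaSeq; field_simp
  have h2 : ((k : ℝ) + r + 2) * etaSeq r β k = 2 * β * (k + r) := by unfold etaSeq; field_simp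
  have h3 : 2 * β * (k + r) * gammaSeq r k = 2 * β * k := by unfold gammaSeq; field_simp
  have h4 : inc x (k + 1) ω = thetaSeq r k • inc x k ω - etaSeq r β k • S k ω := by
    simp only [inc, Nat.add_sub_cancel, h.step k ω]
    abel
  rw [h4, smul_sub, smul_smul, smul_smul, h1, h2, drift, err, target, ← h3]
  module

lemma err_zero (ω : Ω) : err H r x S 0 ω = 0 := by rw [err, h.S_zero, sub_self]

lemma stronglyMeasurable_x (k : ℕ) : StronglyMeasurable[ℱ k] (x k) := by
  induction k using Nat.strong_induction_on with
  | _ k ih =>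
    cases k with
    | zero =>
      have : x 0 = fun _ => x0 := funext h.init
      rw [this]
      exact stronglyMeasurable_const
    | succ k =>
      have h1 := (ih k k.lt_succ_self).mono (ℱ.mono k.le_succ)
      have h2 := (ih (k - 1) (by omega)).mono (ℱ.mono (show k - 1 ≤ k + 1 by omega))
      have e : x (k + 1) = fun ω => x k ω + thetaSeq r k • (x k ω - x (k - 1) ω)
        - etaSeq r β k • S k ω := funext (h.step k)
      rw [e]
      exact (h1.add ((h1.sub h2).const_smul (thetaSeq r k))).sub
        ((h.est.adapted k).const_smul (etaSeq r β k))

lemma stronglyMeasurable_pred (k : ℕ) : StronglyMeasurable[ℱ k] (x (k - 1)) :=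
  (h.stronglyMeasurable_x (k - 1)).mono (ℱ.mono (Nat.sub_le k 1))

variable [IsProbabilityMeasure P]

lemma memLp_avg_comp {y : Ω → Vec p} (hy : AEStronglyMeasurable y P) (hy2 : MemLp y 2 P) :
    MemLp (fun ω => avg H (y ω)) 2 P := by
  obtain ⟨xs, hxs⟩ := h.exists_zero
  refine MemLp.of_le_mul (g := fun ω => y ω - xs) (c := L) (hy2.sub (memLp_const _))
    (h.continuous_avg.comp_aestronglyMeasurable hy) (ae_of_all _ fun ω => ?_)
  simpa [hxs] using h.norm_avg_sub_le (y ω) xs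

lemma memLp_x (k : ℕ) : MemLp (x k) 2 P := by
  induction k using Nat.strong_induction_on with
  | _ k ih =>
    cases k with
    | zero =>
      have : x 0 = fun _ => x0 := funext h.init
      rw [this]
      exact memLp_const _
    | succ k =>
      have h1 := ih k k.lt_succ_self
      have h2 := ih (k - 1) (by omega)
      have h3 := (h.memLp_avg_comp h1.1 h1).sub
        ((h.memLp_avg_comp h2.1 h2).const_smul (gammaSeq r k))
      have hS : MemLp (S k) 2 P := by
        rcases Nat.eq_zero_or_pos k with rfl | hk
        · have : S 0 = target H (gammaSeq r) x 0 := funext h.S_zero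
          rw [this]
          exact h3
        · have e : S k = fun ω => (S k ω - target H (gammaSeq r) x k ω)
            + target H (gammaSeq r) x k ω := by funext ω; simp
          rw [e]
          exact (h.est.error_memLp k hk).add h3
      have e : x (k + 1) = fun ω => x k ω + thetaSeq r k • (x k ω - x (k - 1) ω)
        - etaSeq r β k • S k ω := funext (h.step k)
      rw [e]
      exact (h1.add ((h1.sub h2).const_smul (thetaSeq r k))).sub (hS.const_smul (etaSeq r β k))

lemma memLp_avg (k : ℕ) : MemLp (fun ω => avg H (x k ω)) 2 P :=
  h.memLp_avg_comp (h.memLp_x k).1 (h.memLp_x k)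

lemma memLp_inc (k : ℕ) : MemLp (inc x k) 2 P := (h.memLp_x k).sub (h.memLp_x (k - 1))

lemma memLp_vel (k : ℕ) : MemLp (vel H β x k) 2 P :=
  (h.memLp_inc k).add ((h.memLp_avg (k - 1)).const_smul (2 * β))

omit [IsProbabilityMeasure P] in
lemma stronglyMeasurable_avg {m0 : MeasurableSpace Ω} {y : Ω → Vec p}
    (hy : StronglyMeasurable[m0] y) : StronglyMeasurable[m0] fun ω => avg H (y ω) :=
  h.continuous_avg.comp_stronglyMeasurable hy

omit [IsProbabilityMeasure P] in
lemma stronglyMeasurable_inc (k : ℕ) : StronglyMeasurable[ℱ k] (inc x k) :=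
  (h.stronglyMeasurable_x k).sub (h.stronglyMeasurable_pred k)

omit [IsProbabilityMeasure P] in
lemma stronglyMeasurable_err (k : ℕ) : StronglyMeasurable[ℱ (k + 1)] (err H r x S k) := by
  refine (h.est.adapted k).sub (StronglyMeasurable.mono ?_ (ℱ.mono k.le_succ))
  exact (h.stronglyMeasurable_avg (h.stronglyMeasurable_x k)).sub
    ((h.stronglyMeasurable_avg (h.stronglyMeasurable_pred k)).const_smul (gammaSeq r k))

lemma memLp_err (k : ℕ) : MemLp (err H r x S k) 2 P := by
  rcases Nat.eq_zero_or_pos k with rfl | hk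
  · have : err H r x S 0 = fun _ => 0 := funext h.err_zero
    rw [this]
    exact memLp_const _
  · exact h.est.error_memLp k hk

omit [IsProbabilityMeasure P] in
lemma condExp_err (k : ℕ) : P[err H r x S k | ℱ k] =ᵐ[P] 0 := by
  rcases Nat.eq_zero_or_pos k with rfl | hk
  · have : err H r x S 0 = 0 := funext h.err_zero
    rw [this, condExp_zero]
  · exact h.est.unbiased k hk

/-- The noise level `(k + r)² E Δ_k`. -/
noncomputable def noise (P : Measure Ω) (r : ℝ) (Δ : ℕ → Ω → ℝ) (k : ℕ) : ℝ := (k + r) ^ 2 * ∫ ω, Δ k ω ∂P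

omit [IsProbabilityMeasure P] in
lemma noise_nonneg (k : ℕ) : 0 ≤ noise P r Δ k :=
  mul_nonneg (sq_nonneg _) (integral_nonneg_of_ae (h.est.Delta_nonneg k))

omit [IsProbabilityMeasure P] in
lemma noise_zero : noise P r Δ 0 = 0 := by
  rw [noise, integral_eq_zero_of_ae h.Delta_zero, mul_zero]

lemma err_sq_le_noise (k : ℕ) : (k + r) ^ 2 * ∫ ω, ‖err H r x S k ω‖ ^ 2 ∂P ≤ noise P r Δ k := by
  refine mul_le_mul_of_nonneg_left ?_ (sq_nonneg _)
  rcases Nat.eq_zero_or_pos k with rfl | hk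
  · simp only [h.err_zero, norm_zero, ne_eq, OfNat.ofNat_ne_zero, not_false_eq_true, zero_pow,
      integral_zero]
    exact integral_nonneg_of_ae (h.est.Delta_nonneg 0)
  · rw [← integral_condExp (ℱ.le k), ← integral_condExp (ℱ.le k) (f := Δ k)]
    exact integral_mono_ae integrable_condExp integrable_condExp (h.est.variance_le k hk)

lemma integrable_variation (k : ℕ) : Integrable (variation H x k) P := by
  refine Integrable.const_mul (integrable_finsetSum _ fun i _ => ?_) _
  refine integrable_norm_sq (MemLp.of_le_mul (g := inc x k) (c := L) (h.memLp_inc k) ?_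
    (ae_of_all _ fun ω => (h.cocoercive i).norm_sub_le h.L_pos _ _))
  exact ((h.continuous_comp i).comp_aestronglyMeasurable (h.memLp_x k).1).sub
    ((h.continuous_comp i).comp_aestronglyMeasurable (h.memLp_x (k - 1)).1)

omit h in
lemma variation_nonneg (k : ℕ) (ω : Ω) : 0 ≤ variation H x k ω := by
  unfold variation
  positivity

/-- As `1 - γ_k = r/(k+r)`, the weights of the variance recursion are `(k+r)²/r²`, matching those of
`noise`. -/
lemma noise_succ_le (k : ℕ) : noise P r Δ (k + 1) ≤ (1 - ρ) * noise P r Δ k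
    + Θ * (((k + 1 : ℕ) + r) ^ 2 * ∫ ω, variation H x (k + 1) ω ∂P)
    + Θhat * ((k + r) ^ 2 * ∫ ω, variation H x k ω ∂P) := by
  have hr := h.r_pos
  have hg : ∀ k : ℕ, ∀ a : ℝ, a / (1 - gammaSeq r k) ^ 2 = a * ((k + r) ^ 2 / r ^ 2) := fun k a => by
    have : (0 : ℝ) < k + r := by positivity
    have e : 1 - gammaSeq r k = r / (k + r) := by unfold gammaSeq; field_simp; ring
    rw [e]; field_simp
  have hrec := h.est.recursion (k + 1) (by omega)
  simp only [Nat.add_sub_cancel, hg] at hrec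
  have h1 := integral_mono_ae ((integrable_condExp (m := ℱ (k + 1)) (μ := P)
      (f := Δ (k + 1))).const_mul _)
    ((((h.est.Delta_integrable k).const_mul _).add ((h.integrable_variation (k + 1)).const_mul _)).add
      ((h.integrable_variation k).const_mul _)) hrec
  simp only [Pi.add_apply] at h1
  rw [integral_const_mul, integral_condExp (ℱ.le _), integral_add, integral_add,
    integral_const_mul, integral_const_mul, integral_const_mul] at h1
  rotate_left
  · exact (h.est.Delta_integrable k).const_mul _
  · exact (h.integrable_variation (k + 1)).const_mul _
  · exact ((h.est.Delta_integrable k).const_mul _).add ((h.integrable_variation (k + 1)).const_mul _)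
  · exact (h.integrable_variation k).const_mul _
  unfold noise
  have h2 := mul_le_mul_of_nonneg_left h1 (sq_nonneg r)
  have hr2 : r ^ 2 ≠ 0 := by positivity
  calc ((k + 1 : ℕ) + r) ^ 2 * ∫ ω, Δ (k + 1) ω ∂P
      = r ^ 2 * (1 * (((k + 1 : ℕ) + r) ^ 2 / r ^ 2) * ∫ ω, Δ (k + 1) ω ∂P) := by field_simp
    _ ≤ _ := h2
    _ = _ := by field_simp

end IsFastKM

/-! ### Rates and convergence -/

/-! ### Deterministic limit arguments. -/

section Limits

/-- The convergent sequence `(k+c)² a k`, divided by `k + c`, is summable, so its limit is zero. -/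
lemma tendsto_sq_mul_succ {a : ℕ → ℝ} {r c : ℝ} (hc : 0 < c) (hcr : c ≤ r + 2)
    (ha : ∀ k, 0 ≤ a k) (hl : ∃ l, Tendsto (fun k : ℕ => ((k : ℝ) + c) ^ 2 * a k) atTop (𝓝 l))
    (hs : Summable fun k : ℕ => (2 * (k : ℝ) + r + 3) * a (k + 1)) :
    Tendsto (fun k : ℕ => (k : ℝ) ^ 2 * a (k + 1)) atTop (𝓝 0) := by
  obtain ⟨l, hl⟩ := hl
  have h0 : Tendsto (fun k : ℕ => ((k : ℝ) + c) ^ 2 * a k) atTop (𝓝 0) := by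
    refine tendsto_zero_of_summable_div hc (fun k => mul_nonneg (sq_nonneg _) (ha k)) hl ?_
    have e : ∀ k : ℕ, ((k : ℝ) + c) ^ 2 * a k / (k + c) = (k + c) * a k := fun k => by
      have : (0 : ℝ) < k + c := by positivity
      field_simp
    simp_rw [e]
    refine (summable_nat_add_iff 1).1 (Summable.of_nonneg_of_le (fun k => ?_) (fun k => ?_) hs)
    · exact mul_nonneg (by positivity) (ha _)
    · refine mul_le_mul_of_nonneg_right ?_ (ha _)
      push_cast
      linarith [k.cast_nonneg (α := ℝ)]
  refine squeeze_zero (fun k => mul_nonneg (sq_nonneg _) (ha _)) (fun k => ?_)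
    (h0.comp (tendsto_add_atTop_nat 1))
  refine mul_le_mul_of_nonneg_right (pow_le_pow_left₀ k.cast_nonneg ?_ 2) (ha _)
  push_cast
  linarith

lemma tendsto_sq_mul_of_succ {a : ℕ → ℝ} (ha : ∀ k, 0 ≤ a k)
    (h : Tendsto (fun k : ℕ => (k : ℝ) ^ 2 * a (k + 1)) atTop (𝓝 0)) :
    Tendsto (fun k : ℕ => (k : ℝ) ^ 2 * a k) atTop (𝓝 0) := by
  refine (tendsto_add_atTop_iff_nat 1).1 ?_
  refine squeeze_zero' (Eventually.of_forall fun k => mul_nonneg (sq_nonneg _) (ha _)) ?_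
    (by simpa using h.const_mul 4)
  filter_upwards [eventually_ge_atTop 1] with k hk
  have hk1 : (1 : ℝ) ≤ k := by exact_mod_cast hk
  rw [← mul_assoc]
  refine mul_le_mul_of_nonneg_right ?_ (ha _)
  push_cast
  nlinarith

variable {E : Type*} [NormedAddCommGroup E] [InnerProductSpace ℝ E]

/-- The energy bounds `‖y k‖`, and then differs from `r(r+1)‖y k‖²` by products containing `k‖d k‖`
or `k‖g k‖`, which vanish in the limit. -/
lemma tendsto_norm_of_tendsto_energy {r β l : ℝ} (hr : 0 < r) (hβ : 0 ≤ β) {y d g : ℕ → E}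
    (hl : Tendsto (fun k : ℕ => energy r β k (y k) (d k) (g k)) atTop (𝓝 l))
    (hco : ∀ k, β * ‖g k‖ ^ 2 ≤ inner ℝ (g k) (y k - d k))
    (hd : Tendsto (fun k : ℕ => (k : ℝ) ^ 2 * ‖d k‖ ^ 2) atTop (𝓝 0))
    (hg : Tendsto (fun k : ℕ => (k : ℝ) ^ 2 * ‖g k‖ ^ 2) atTop (𝓝 0)) :
    ∃ l', Tendsto (fun k => ‖y k‖) atTop (𝓝 l') := by
  have hsqrt : ∀ v : ℕ → E, Tendsto (fun k : ℕ => (k : ℝ) ^ 2 * ‖v k‖ ^ 2) atTop (𝓝 0) →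
      Tendsto (fun k : ℕ => (k : ℝ) * ‖v k‖) atTop (𝓝 0) := fun v hv => by
    have := hv.sqrt
    rw [Real.sqrt_zero] at this
    refine this.congr fun k => ?_
    rw [← mul_pow, Real.sqrt_sq (by positivity)]
  have hα := hsqrt d hd
  have hγ := hsqrt g hg
  set α : ℕ → ℝ := fun k => (k : ℝ) * ‖d k‖
  set γ : ℕ → ℝ := fun k => (k : ℝ) * ‖g k‖
  obtain ⟨M, hM⟩ := hl.bddAbove_range
  set B := Real.sqrt (M / r)
  have hB : ∀ k, ‖y k‖ ≤ B := fun k => by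
    refine Real.le_sqrt_of_sq_le ((le_div_iff₀' hr).2 ?_)
    exact (mul_norm_sq_le_energy hβ k.cast_nonneg hr.le (hco k)).trans (hM ⟨k, rfl⟩)
  have hdiff : ∀ k : ℕ, |energy r β k (y k) (d k) (g k) - r * (r + 1) * ‖y k‖ ^ 2|
      ≤ 2 * r * B * α k + α k ^ 2 + 4 * β * r * (γ k * B + γ k * α k) + 4 * β ^ 2 * r * γ k ^ 2 := by
    intro k
    have hk0 : (0 : ℝ) ≤ k := k.cast_nonneg
    -- The energy carries one factor `k` on the terms quadratic in `g` and `d`, while `α` and `γ`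
    -- supply two.
    have hk2 : (k : ℝ) ≤ (k : ℝ) ^ 2 := by
      rcases Nat.eq_zero_or_pos k with rfl | hk
      · simp
      · have : (1 : ℝ) ≤ k := by exact_mod_cast hk
        nlinarith
    have e : energy r β k (y k) (d k) (g k) - r * (r + 1) * ‖y k‖ ^ 2
        = 2 * r * (k * inner ℝ (y k) (d k)) + α k ^ 2 + 4 * β * r * (k * inner ℝ (g k) (y k))
          - 4 * β * r * (k * inner ℝ (g k) (d k)) - 4 * β ^ 2 * r * (k * ‖g k‖ ^ 2) := by
      rw [energy, norm_add_sq_real, norm_smul, norm_smul, mul_pow, mul_pow, Real.norm_eq_abs,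
        Real.norm_eq_abs, sq_abs, sq_abs, real_inner_smul_left, real_inner_smul_right,
        inner_sub_right]
      ring
    have i1 : |(k : ℝ) * inner ℝ (y k) (d k)| ≤ B * α k := by
      rw [abs_mul, abs_of_nonneg hk0]
      calc _ ≤ (k : ℝ) * (‖y k‖ * ‖d k‖) :=
            mul_le_mul_of_nonneg_left (abs_real_inner_le_norm _ _) hk0
        _ = ‖y k‖ * α k := by ring
        _ ≤ B * α k := mul_le_mul_of_nonneg_right (hB k) (by positivity)
    have i2 : |(k : ℝ) * inner ℝ (g k) (y k)| ≤ γ k * B := by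
      rw [abs_mul, abs_of_nonneg hk0]
      calc _ ≤ (k : ℝ) * (‖g k‖ * ‖y k‖) :=
            mul_le_mul_of_nonneg_left (abs_real_inner_le_norm _ _) hk0
        _ = γ k * ‖y k‖ := by ring
        _ ≤ γ k * B := mul_le_mul_of_nonneg_left (hB k) (by positivity)
    have i3 : |(k : ℝ) * inner ℝ (g k) (d k)| ≤ γ k * α k := by
      rw [abs_mul, abs_of_nonneg hk0]
      calc _ ≤ (k : ℝ) * (‖g k‖ * ‖d k‖) :=
            mul_le_mul_of_nonneg_left (abs_real_inner_le_norm _ _) hk0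
        _ ≤ (k : ℝ) ^ 2 * (‖g k‖ * ‖d k‖) := mul_le_mul_of_nonneg_right hk2 (by positivity)
        _ = γ k * α k := by ring
    have i4 : |(k : ℝ) * ‖g k‖ ^ 2| ≤ γ k ^ 2 := by
      rw [abs_of_nonneg (by positivity)]
      calc _ ≤ (k : ℝ) ^ 2 * ‖g k‖ ^ 2 := mul_le_mul_of_nonneg_right hk2 (by positivity)
        _ = γ k ^ 2 := by ring
    rw [abs_le] at i1 i2 i3 i4
    have hr2 : 0 ≤ 2 * r := by linarith
    have hβr : 0 ≤ 4 * β * r := by positivity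
    have hβr2 : 0 ≤ 4 * β ^ 2 * r := by positivity
    have a1 := mul_le_mul_of_nonneg_left i1.1 hr2
    have a2 := mul_le_mul_of_nonneg_left i1.2 hr2
    have b1 := mul_le_mul_of_nonneg_left i2.1 hβr
    have b2 := mul_le_mul_of_nonneg_left i2.2 hβr
    have c1 := mul_le_mul_of_nonneg_left i3.1 hβr
    have c2 := mul_le_mul_of_nonneg_left i3.2 hβr
    have d1 := mul_le_mul_of_nonneg_left i4.1 hβr2
    have d2 := mul_le_mul_of_nonneg_left i4.2 hβr2
    rw [e, abs_le]
    constructor <;> linarith [sq_nonneg (α k)]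
  have hlim : Tendsto (fun k : ℕ => 2 * r * B * α k + α k ^ 2
      + 4 * β * r * (γ k * B + γ k * α k) + 4 * β ^ 2 * r * γ k ^ 2) atTop (𝓝 0) := by
    have := (((hα.const_mul (2 * r * B)).add (hα.pow 2)).add
      (((hγ.mul_const B).add (hγ.mul hα)).const_mul (4 * β * r))).add
      ((hγ.pow 2).const_mul (4 * β ^ 2 * r))
    simpa using this
  have hz := squeeze_zero_norm
    (f := fun k : ℕ => energy r β k (y k) (d k) (g k) - r * (r + 1) * ‖y k‖ ^ 2) hdiff hlim
  have hy := ((hl.sub hz).div_const (r * (r + 1))).sqrt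
  refine ⟨_, hy.congr fun k => ?_⟩
  rw [sub_sub_cancel, mul_div_cancel_left₀ _ (by positivity), Real.sqrt_sq (norm_nonneg _)]

/-- **Opial's lemma** in finite dimension, with the distances known to converge only for a dense
set of zeros of `F`. -/
lemma exists_tendsto_zero_of_dense [FiniteDimensional ℝ E] {F : E → E} (hF : Continuous F)
    {D : Set E} (hD0 : D.Nonempty) (hD : {z | F z = 0} ⊆ closure D) {x : ℕ → E}
    (hx : ∀ z ∈ D, ∃ l, Tendsto (fun k => ‖x k - z‖) atTop (𝓝 l))
    (hFx : Tendsto (fun k => F (x k)) atTop (𝓝 0)) :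
    ∃ z, F z = 0 ∧ Tendsto x atTop (𝓝 z) := by
  obtain ⟨z0, hz0⟩ := hD0
  obtain ⟨l, hl⟩ := hx z0 hz0
  obtain ⟨M, hM⟩ := hl.bddAbove_range
  obtain ⟨z, -, φ, hφ, hz⟩ := tendsto_subseq_of_bounded (x := x) (s := Metric.closedBall z0 M)
    Metric.isBounded_closedBall (fun k => mem_closedBall_iff_norm.2 (hM ⟨k, rfl⟩))
  have hFz : F z = 0 := tendsto_nhds_unique ((hF.tendsto z).comp hz) (hFx.comp hφ.tendsto_atTop)
  refine ⟨z, hFz, Metric.tendsto_atTop'.2 fun ε hε => ?_⟩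
  -- The cluster point `z` need not lie in `D`; a nearby `w ∈ D` has `‖x k - w‖` convergent to `‖z -
  -- w‖ < ε / 2`.
  obtain ⟨w, hw, hzw⟩ := Metric.mem_closure_iff.1 (hD hFz) (ε / 2) (half_pos hε)
  obtain ⟨l', hl'⟩ := hx w hw
  have : l' = ‖z - w‖ :=
    tendsto_nhds_unique (hl'.comp hφ.tendsto_atTop) ((hz.sub_const w).norm)
  rw [dist_eq_norm] at hzw
  obtain ⟨N, hN⟩ := eventually_atTop.1 (hl'.eventually (gt_mem_nhds (this ▸ hzw)))
  refine ⟨N, fun k hk => ?_⟩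
  have h1 := hN k hk.le
  rw [dist_eq_norm, show x k - z = (x k - w) - (z - w) by abel]
  linarith [norm_sub_le (x k - w) (z - w)]

end Limits

/-! ### Bounds in expectation, rates and almost sure convergence. -/

namespace IsFastKM

variable {n p : ℕ} {Ω : Type*} {mΩ : MeasurableSpace Ω} {P : Measure Ω}
  {ℱ : Filtration ℕ mΩ} {H : Fin n → Vec p → Vec p} {L r β ρ Θ Θhat : ℝ} {x0 xs : Vec p}
  {x S : ℕ → Ω → Vec p} {Δ : ℕ → Ω → ℝ}

/-- The drift along the iterates. -/
noncomputable def dft (H : Fin n → Vec p → Vec p) (r β : ℝ) (x : ℕ → Ω → Vec p) (k : ℕ) (ω : Ω) :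
    Vec p :=
  drift r β k (inc x k ω) (avg H (x (k - 1) ω)) (avg H (x k ω))

/-- The Lyapunov function along the iterates. -/
noncomputable def en (H : Fin n → Vec p → Vec p) (r β : ℝ) (xs : Vec p) (x : ℕ → Ω → Vec p)
    (k : ℕ) (ω : Ω) : ℝ :=
  energy r β k (x k ω - xs) (inc x k ω) (avg H (x (k - 1) ω))

/-- The weighted squared error. -/
noncomputable def errSq (H : Fin n → Vec p → Vec p) (r β : ℝ) (x S : ℕ → Ω → Vec p) (k : ℕ)
    (ω : Ω) : ℝ :=
  4 * β ^ 2 * (k + r) ^ 2 * ‖err H r x S k ω‖ ^ 2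

lemma errSq_nonneg (k : ℕ) (ω : Ω) : 0 ≤ errSq H r β x S k ω := by
  unfold errSq
  positivity

variable (h : IsFastKM P ℱ H L r β ρ Θ Θhat x0 x S Δ)
include h

lemma en_step (hxs : avg H xs = 0) (k : ℕ) (ω : Ω) :
    en H r β xs x (k + 1) ω + (2 * k + r + 3) * ‖inc x (k + 1) ω‖ ^ 2
        + 4 * β * k * (k + r) * (1 / L - β) * variation H x k ω
      ≤ en H r β xs x k ω + errSq H r β x S k ω - inner ℝ (err H r x S k ω)
        ((4 * β * (k + r)) • (dft H r β x k ω + r • (x k ω - xs))) := by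
  have hr := h.two_lt
  have hβ := h.beta_pos
  have hs := energy_step (y := x k ω - xs) (h.step_inc k ω)
  have e1 : x k ω - xs + inc x (k + 1) ω = x (k + 1) ω - xs := by
    rw [x_succ (x := x) k ω]; abel
  rw [e1] at hs
  have e2 : en H r β xs x (k + 1) ω = energy r β (k + 1) (x (k + 1) ω - xs) (inc x (k + 1) ω)
      (avg H (x k ω)) := by rw [en]; push_cast; rfl
  have h1 := h.beta_mul_norm_sq_le (x k ω) xs
  rw [hxs, sub_zero] at h1
  have h2 := mean_sq_le_inner h.cocoercive (x k ω) (x (k - 1) ω)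
  have h3 : ‖avg H (x k ω) - avg H (x (k - 1) ω)‖ ^ 2 ≤ variation H x k ω := by
    rw [avg_sub]
    exact norm_avg_sq_le _ h.n_pos
  -- Co-coercivity supplies `1/L` of the variation; the part `β` pays for the squared norm of the
  -- averaged difference, by Jensen.
  have h4 : (1 / L - β) * variation H x k ω
      ≤ inner ℝ (avg H (x k ω) - avg H (x (k - 1) ω)) (inc x k ω)
        - β * ‖avg H (x k ω) - avg H (x (k - 1) ω)‖ ^ 2 := by
    have := mul_le_mul_of_nonneg_left h3 hβ.le
    rw [variation] at *
    rw [inc]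
    linarith
  have h5 := mul_le_mul_of_nonneg_left h4
    (by positivity : 0 ≤ 4 * β * k * (k + r))
  have h6 : 0 ≤ 4 * β * r * (r - 1) * (inner ℝ (avg H (x k ω)) (x k ω - xs)
      - β * ‖avg H (x k ω)‖ ^ 2) :=
    mul_nonneg (mul_nonneg (by positivity) (by linarith)) (by linarith)
  rw [e2, hs, en, errSq, dft]
  linarith

lemma en_nonneg (hxs : avg H xs = 0) (k : ℕ) (ω : Ω) :
    β * ‖avg H (x (k - 1) ω)‖ ^ 2 ≤ inner ℝ (avg H (x (k - 1) ω)) (x k ω - xs - inc x k ω) ∧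
      0 ≤ en H r β xs x k ω := by
  have h1 := h.beta_mul_norm_sq_le (x (k - 1) ω) xs
  rw [hxs, sub_zero] at h1
  have e : x k ω - xs - inc x k ω = x (k - 1) ω - xs := by rw [inc]; abel
  rw [e]
  refine ⟨h1, le_trans ?_ (mul_norm_sq_le_energy h.beta_pos.le k.cast_nonneg h.r_pos.le
    (by rwa [e]))⟩
  have := h.r_pos
  positivity

lemma inc_step (k : ℕ) (ω : Ω) :
    (k + r + 2) ^ 2 * ‖inc x (k + 1) ω‖ ^ 2 ≤ k * (k + 2 * r) * ‖inc x k ω‖ ^ 2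
      + (β ^ 2 * r * (2 * k + 4 * r) * ‖avg H (x k ω)‖ ^ 2 + errSq H r β x S k ω)
      - inner ℝ (err H r x S k ω) ((4 * β * (k + r)) • dft H r β x k ω) := by
  have hs := increment_step (d := inc x k ω) h.beta_pos.le k.cast_nonneg h.r_pos
    (h.beta_mul_norm_sq_le (x k ω) (x (k - 1) ω)) (h.step_inc k ω)
  rw [errSq, dft]
  linarith

lemma vel_step (k : ℕ) (ω : Ω) :
    (k + r) ^ 2 * ‖vel H β x (k + 1) ω‖ ^ 2 ≤ k * (k + r) * ‖vel H β x k ω‖ ^ 2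
      + (4 * (k + r) / r * ‖inc x (k + 1) ω‖ ^ 2 + errSq H r β x S k ω)
      - inner ℝ (err H r x S k ω)
        (velocityDir r β k (inc x k ω) (avg H (x (k - 1) ω)) (avg H (x k ω))) := by
  have hs := velocity_step k.cast_nonneg h.r_pos (h.step_inc k ω)
  have e : vel H β x (k + 1) ω = inc x (k + 1) ω + (2 * β) • avg H (x k ω) := rfl
  rw [errSq, e, vel]
  linarith

lemma stronglyMeasurable_dft (k : ℕ) : StronglyMeasurable[ℱ k] (dft H r β x k) :=
  (((h.stronglyMeasurable_inc k).const_smul (k : ℝ)).sub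
    ((h.stronglyMeasurable_avg (h.stronglyMeasurable_x k)).const_smul (2 * β * (k + r)))).add
    ((h.stronglyMeasurable_avg (h.stronglyMeasurable_pred k)).const_smul (2 * β * k))

lemma stronglyMeasurable_enDir (k : ℕ) : StronglyMeasurable[ℱ k] fun ω =>
    (4 * β * (k + r)) • (dft H r β x k ω + r • (x k ω - xs)) :=
  ((h.stronglyMeasurable_dft k).add
    (((h.stronglyMeasurable_x k).sub stronglyMeasurable_const).const_smul r)).const_smul
    (4 * β * (k + r))

lemma stronglyMeasurable_velocityDir (k : ℕ) : StronglyMeasurable[ℱ k] fun ω =>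
    velocityDir r β k (inc x k ω) (avg H (x (k - 1) ω)) (avg H (x k ω)) := by
  have h1 := h.stronglyMeasurable_dft k
  have h2 := (h.stronglyMeasurable_inc k).add
    ((h.stronglyMeasurable_avg (h.stronglyMeasurable_pred k)).const_smul (2 * β))
  have h3 := ((h2.const_smul (k : ℝ)).sub (h1.const_smul (2 / ((k : ℝ) + r + 2)))).const_smul
    (4 * β * (k + r) ^ 2 / (k + r + 2))
  exact h3.sub (h1.const_smul (16 * β * (k + r) ^ 2 / (r * (k + r + 2) ^ 2)))

variable [IsProbabilityMeasure P]

lemma memLp_dft (k : ℕ) : MemLp (dft H r β x k) 2 P :=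
  (((h.memLp_inc k).const_smul (k : ℝ)).sub ((h.memLp_avg k).const_smul (2 * β * (k + r)))).add
    ((h.memLp_avg (k - 1)).const_smul (2 * β * k))

lemma memLp_enDir (k : ℕ) : MemLp (fun ω =>
    (4 * β * (k + r)) • (dft H r β x k ω + r • (x k ω - xs))) 2 P :=
  ((h.memLp_dft k).add (((h.memLp_x k).sub (memLp_const xs)).const_smul r)).const_smul
    (4 * β * (k + r))

lemma memLp_velocityDir (k : ℕ) : MemLp (fun ω =>
    velocityDir r β k (inc x k ω) (avg H (x (k - 1) ω)) (avg H (x k ω))) 2 P := by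
  have h1 := h.memLp_dft k
  have h3 := (((h.memLp_vel k).const_smul (k : ℝ)).sub
    (h1.const_smul (2 / ((k : ℝ) + r + 2)))).const_smul (4 * β * (k + r) ^ 2 / (k + r + 2))
  exact h3.sub (h1.const_smul (16 * β * (k + r) ^ 2 / (r * (k + r + 2) ^ 2)))

lemma integrable_inc (k : ℕ) : Integrable (fun ω => ‖inc x k ω‖ ^ 2) P :=
  integrable_norm_sq (h.memLp_inc k)

lemma integrable_vel (k : ℕ) : Integrable (fun ω => ‖vel H β x k ω‖ ^ 2) P :=
  integrable_norm_sq (h.memLp_vel k)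

lemma integrable_avg (k : ℕ) : Integrable (fun ω => ‖avg H (x k ω)‖ ^ 2) P :=
  integrable_norm_sq (h.memLp_avg k)

lemma integrable_errSq (k : ℕ) : Integrable (errSq H r β x S k) P :=
  (integrable_norm_sq (h.memLp_err k)).const_mul _

lemma integrable_en (k : ℕ) : Integrable (en H r β xs x k) P := by
  have hy := (h.memLp_x k).sub (memLp_const xs)
  exact ((integrable_norm_sq ((hy.const_smul r).add ((h.memLp_inc k).const_smul (k : ℝ)))).add
    ((integrable_norm_sq hy).const_mul r)).add
    (((integrable_inner_of_memLp (h.memLp_avg (k - 1)) (hy.sub (h.memLp_inc k))).sub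
      ((h.integrable_avg (k - 1)).const_mul β)).const_mul (4 * β * k * r))

lemma integral_errSq_le (k : ℕ) : ∫ ω, errSq H r β x S k ω ∂P ≤ 4 * β ^ 2 * noise P r Δ k := by
  unfold errSq
  rw [integral_const_mul, mul_assoc]
  exact mul_le_mul_of_nonneg_left (h.err_sq_le_noise k) (by positivity)

/-- Taking expectations removes the noise product, because `m` is known at time `k` and the error is
centred given `ℱ k`. -/
lemma integral_le_of_step {X X' : Ω → ℝ} {m : Ω → Vec p} (k : ℕ) (hm : StronglyMeasurable[ℱ k] m)
    (hm2 : MemLp m 2 P) (hX : Integrable X P) (hX' : Integrable X' P)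
    (hle : ∀ ω, X' ω ≤ X ω - inner ℝ (err H r x S k ω) (m ω)) :
    ∫ ω, X' ω ∂P ≤ ∫ ω, X ω ∂P := by
  have hi := integrable_inner_of_memLp (h.memLp_err k) hm2
  have h1 := integral_mono hX' (hX.sub hi) hle
  simp only [Pi.sub_apply] at h1
  rwa [integral_sub hX hi, integral_inner_eq_zero (ℱ.le k) (h.memLp_err k) hm hm2 (h.condExp_err k),
    sub_zero] at h1

lemma noise_sum_le (N : ℕ) : ρ * ∑ k ∈ Finset.range N, noise P r Δ k
    ≤ (Θ + Θhat) * ∑ k ∈ Finset.range N, ((k : ℝ) + r) ^ 2 * ∫ ω, variation H x k ω ∂P := by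
  refine mul_sum_noise_le (W := fun k : ℕ => ((k : ℝ) + r) ^ 2 * ∫ ω, variation H x k ω ∂P)
    h.est.rho_le_one h.est.Thetahat_nonneg h.noise_nonneg (fun k => ?_) h.noise_zero ?_
    h.noise_succ_le N
  · exact mul_nonneg (sq_nonneg _) (integral_nonneg (variation_nonneg k))
  · simp [variation]

lemma sum_energy (hxs : avg H xs = 0) (N : ℕ) :
    ∑ k ∈ Finset.range N, (2 * (k : ℝ) + r + 3) * ∫ ω, ‖inc x (k + 1) ω‖ ^ 2 ∂P
      + Lam L r β ρ (Θ + Θhat) * ∑ k ∈ Finset.range N,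
        ((k : ℝ) + r) ^ 2 * ∫ ω, variation H x k ω ∂P ≤ r * (r + 1) * ‖x0 - xs‖ ^ 2 := by
  have e0 : ∫ ω, en H r β xs x 0 ω ∂P = r * (r + 1) * ‖x0 - xs‖ ^ 2 := by
    simp only [en, Nat.cast_zero, energy_eq_zero_index, h.init]
    simp
  rw [← e0]
  refine sum_energy_le (A := fun k => ∫ ω, en H r β xs x k ω ∂P)
    (U := fun k => ∫ ω, variation H x k ω ∂P) (D := noise P r Δ)
    (W := fun k : ℕ => ((k : ℝ) + r) ^ 2 * ∫ ω, variation H x k ω ∂P)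
    h.L_pos h.two_lt h.beta_pos h.est.rho_pos h.Theta_nonneg h.beta_lt
    (fun k => integral_nonneg fun ω => (h.en_nonneg hxs k ω).2)
    (fun k => integral_nonneg (variation_nonneg k)) (by simp [variation]) (fun k => rfl)
    h.noise_sum_le (fun k => ?_) N
  have i1 := h.integrable_en (xs := xs) (k + 1)
  have i2 := (h.integrable_inc (k + 1)).const_mul (2 * k + r + 3)
  have i3 := (h.integrable_variation k).const_mul (4 * β * k * (k + r) * (1 / L - β))
  have i12 : Integrable (fun ω => en H r β xs x (k + 1) ω
    + (2 * k + r + 3) * ‖inc x (k + 1) ω‖ ^ 2) P := i1.add i2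
  have key := h.integral_le_of_step k (h.stronglyMeasurable_enDir (xs := xs) k) (h.memLp_enDir k)
    ((h.integrable_en (xs := xs) k).add (h.integrable_errSq k)) (i12.add i3)
    (h.en_step hxs k)
  simp only [Pi.add_apply] at key
  rw [integral_add i12 i3, integral_add i1 i2, integral_const_mul, integral_const_mul,
    integral_add (h.integrable_en k) (h.integrable_errSq k)] at key
  linarith [h.integral_errSq_le k]

lemma sum_inc_le (hxs : avg H xs = 0) (N : ℕ) :
    ∑ k ∈ Finset.range N, (2 * (k : ℝ) + r + 3) * ∫ ω, ‖inc x (k + 1) ω‖ ^ 2 ∂P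
      ≤ r * (r + 1) * ‖x0 - xs‖ ^ 2 := by
  refine le_trans (le_add_of_nonneg_right (mul_nonneg ?_ ?_)) (h.sum_energy hxs N)
  · exact (Lam_pos h.L_pos h.two_lt h.beta_pos h.est.rho_pos h.Theta_nonneg h.beta_lt).le
  · exact Finset.sum_nonneg fun k _ =>
      mul_nonneg (sq_nonneg _) (integral_nonneg (variation_nonneg k))

lemma sum_noise_le (hxs : avg H xs = 0) (N : ℕ) :
    4 * β ^ 2 * ∑ k ∈ Finset.range N, noise P r Δ k
      ≤ psi L r β ρ (Θ + Θhat) * (r * (r + 1) * ‖x0 - xs‖ ^ 2) := by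
  refine sum_noise_le_psi h.est.rho_pos h.Theta_nonneg
    (Lam_pos h.L_pos h.two_lt h.beta_pos h.est.rho_pos h.Theta_nonneg h.beta_lt)
    h.noise_sum_le (fun N => ?_) N
  refine le_trans (le_add_of_nonneg_left ?_) (h.sum_energy hxs N)
  have := h.r_pos
  exact Finset.sum_nonneg fun k _ =>
    mul_nonneg (by positivity) (integral_nonneg fun ω => sq_nonneg _)

lemma vel_bounds (hxs : avg H xs = 0) (N : ℕ) :
    (N + r) ^ 2 * ∫ ω, ‖vel H β x (N + 1) ω‖ ^ 2 ∂P
      ≤ C1 L r β ρ (Θ + Θhat) * ‖x0 - xs‖ ^ 2 ∧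
    ∑ k ∈ Finset.range N, (2 * (k : ℝ) + r + 3) * ∫ ω, ‖vel H β x (k + 1) ω‖ ^ 2 ∂P
      ≤ 2 * C1 L r β ρ (Θ + Θhat) / (r - 2) * ‖x0 - xs‖ ^ 2 := by
  refine velocity_bounds (V := fun k => ∫ ω, ‖vel H β x k ω‖ ^ 2 ∂P)
    (q := fun k => ∫ ω, ‖inc x (k + 1) ω‖ ^ 2 ∂P) (D := noise P r Δ)
    h.L_pos h.two_lt h.beta_pos h.est.rho_pos h.Theta_nonneg h.beta_lt (sq_nonneg _)
    (fun k => integral_nonneg fun ω => sq_nonneg _) (fun k => integral_nonneg fun ω => sq_nonneg _)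
    (h.sum_inc_le hxs) (h.sum_noise_le hxs) (fun k => ?_) N
  have i1 := (h.integrable_vel k).const_mul (k * (k + r))
  have i2 := (h.integrable_inc (k + 1)).const_mul (4 * (k + r) / r)
  have i3 := h.integrable_errSq k
  have i23 : Integrable (fun ω => 4 * (k + r) / r * ‖inc x (k + 1) ω‖ ^ 2
    + errSq H r β x S k ω) P := i2.add i3
  have key := h.integral_le_of_step k (h.stronglyMeasurable_velocityDir k) (h.memLp_velocityDir k)
    (i1.add i23) ((h.integrable_vel (k + 1)).const_mul ((k + r) ^ 2)) (h.vel_step k)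
  simp only [Pi.add_apply] at key
  rw [integral_add i1 i23, integral_add i2 i3, integral_const_mul, integral_const_mul,
    integral_const_mul] at key
  linarith [h.integral_errSq_le k]

omit h [IsProbabilityMeasure P] in
lemma norm_avg_sq_le_vel (k : ℕ) (ω : Ω) : 4 * β ^ 2 * ‖avg H (x k ω)‖ ^ 2
    ≤ 2 * ‖vel H β x (k + 1) ω‖ ^ 2 + 2 * ‖inc x (k + 1) ω‖ ^ 2 :=
  residual_le (inc x (k + 1) ω) (avg H (x k ω)) β

lemma integral_avg_le (k : ℕ) : 4 * β ^ 2 * ∫ ω, ‖avg H (x k ω)‖ ^ 2 ∂P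
    ≤ 2 * ∫ ω, ‖vel H β x (k + 1) ω‖ ^ 2 ∂P + 2 * ∫ ω, ‖inc x (k + 1) ω‖ ^ 2 ∂P := by
  have i1 := (h.integrable_vel (k + 1)).const_mul 2
  have i2 := (h.integrable_inc (k + 1)).const_mul 2
  have key := integral_mono ((h.integrable_avg k).const_mul (4 * β ^ 2)) (i1.add i2)
    (norm_avg_sq_le_vel k)
  simp only [Pi.add_apply] at key
  rwa [integral_add i1 i2, integral_const_mul, integral_const_mul, integral_const_mul] at key

lemma sum_avg_le (hxs : avg H xs = 0) (N : ℕ) :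
    ∑ k ∈ Finset.range N, (2 * (k : ℝ) + r + 3) * ∫ ω, ‖avg H (x k ω)‖ ^ 2 ∂P
      ≤ (r + 2) ^ 2 / (2 * β ^ 2 * r ^ 2)
        * (C0 L r β + 2 * C1 L r β ρ (Θ + Θhat) / (r - 2)) * ‖x0 - xs‖ ^ 2 :=
  residual_sum_bound h.L_pos h.two_lt h.beta_pos h.est.rho_pos h.Theta_nonneg h.beta_lt
    (V := fun k => ∫ ω, ‖vel H β x k ω‖ ^ 2 ∂P) (sq_nonneg _)
    (h.sum_inc_le hxs) (fun N => (h.vel_bounds hxs N).2) h.integral_avg_le N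

lemma inc_bound (hxs : avg H xs = 0) (N : ℕ) :
    (N + r + 2) ^ 2 * ∫ ω, ‖inc x (N + 1) ω‖ ^ 2 ∂P
      ≤ C2 L r β ρ (Θ + Θhat) * ‖x0 - xs‖ ^ 2 := by
  refine increment_bound (d := fun k => ∫ ω, ‖inc x k ω‖ ^ 2 ∂P)
    (H := fun k => ∫ ω, ‖avg H (x k ω)‖ ^ 2 ∂P) (D := noise P r Δ)
    h.L_pos h.two_lt h.beta_pos h.est.rho_pos h.Theta_nonneg h.beta_lt (sq_nonneg _)
    (fun k => integral_nonneg fun ω => sq_nonneg _) (by simp [inc])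
    (fun k => integral_nonneg fun ω => sq_nonneg _)
    (h.sum_avg_le hxs) (h.sum_noise_le hxs) (fun k => ?_) N
  have i1 := (h.integrable_inc k).const_mul (k * (k + 2 * r))
  have i2 := (h.integrable_avg k).const_mul (β ^ 2 * r * (2 * k + 4 * r))
  have i3 := h.integrable_errSq k
  have i23 : Integrable (fun ω => β ^ 2 * r * (2 * k + 4 * r) * ‖avg H (x k ω)‖ ^ 2
    + errSq H r β x S k ω) P := i2.add i3
  have key := h.integral_le_of_step k
    ((h.stronglyMeasurable_dft k).const_smul (4 * β * (k + r)))
    ((h.memLp_dft k).const_smul (4 * β * (k + r)))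
    (i1.add i23) ((h.integrable_inc (k + 1)).const_mul ((k + r + 2) ^ 2)) (h.inc_step k)
  simp only [Pi.add_apply] at key
  rw [integral_add i1 i23, integral_add i2 i3, integral_const_mul, integral_const_mul,
    integral_const_mul] at key
  linarith [h.integral_errSq_le k]

theorem incrementBounds (hxs : avg H xs = 0) :
    IncrementBounds P L r β ρ (Θ + Θhat) (‖x0 - xs‖ ^ 2) fun k ω => ‖inc x (k + 1) ω‖ ^ 2 := by
  have hr := h.r_pos
  refine ⟨.of_partial hr.le (fun k ω => sq_nonneg _) (fun k => h.integrable_inc (k + 1))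
    fun N => (h.sum_inc_le hxs N).trans (mul_le_mul_of_nonneg_right ?_ (sq_nonneg _)), fun k => ?_⟩
  · have := C0_ge (L := L) (β := β) h.two_lt
    have : 0 ≤ r * (r + 1) := by positivity
    linarith
  · rw [le_div_iff₀ (by positivity), mul_comm]
    exact h.inc_bound hxs k

theorem residualBounds (hxs : avg H xs = 0) :
    ResidualBounds P L r β ρ (Θ + Θhat) (‖x0 - xs‖ ^ 2) fun k ω => ‖avg H (x k ω)‖ ^ 2 := by
  have hrate := fun k => residual_rate h.L_pos h.two_lt h.beta_pos h.est.rho_pos h.Theta_nonneg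
    h.beta_lt (V := fun k => ∫ ω, ‖vel H β x k ω‖ ^ 2 ∂P)
    (q := fun k => ∫ ω, ‖inc x (k + 1) ω‖ ^ 2 ∂P) (H := fun k => ∫ ω, ‖avg H (x k ω)‖ ^ 2 ∂P)
    (sq_nonneg _) k (h.vel_bounds hxs k).1 (h.inc_bound hxs k) (h.integral_avg_le k)
  exact ⟨.of_partial h.r_pos.le (fun k ω => sq_nonneg _) h.integrable_avg (h.sum_avg_le hxs), hrate,
    fun ε hε k hk => complexity_of_rate h.L_pos h.two_lt h.beta_pos h.est.rho_pos h.Theta_nonneg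
      h.beta_lt (sq_nonneg _) hε k (hrate k) hk⟩

lemma summable_integral_errSq : Summable fun k => ∫ ω, errSq H r β x S k ω ∂P := by
  obtain ⟨xs, hxs⟩ := h.exists_zero
  refine summable_of_sum_range_le (c := psi L r β ρ (Θ + Θhat) * (r * (r + 1) * ‖x0 - xs‖ ^ 2))
    (fun k => integral_nonneg (errSq_nonneg k)) fun N => ?_
  refine le_trans (Finset.sum_le_sum fun k _ => h.integral_errSq_le k) ?_
  rw [← Finset.mul_sum]
  exact h.sum_noise_le hxs N

/-- One recursion serves twice: integrated it gives convergence of `(k+c)² E a_k`, pathwise the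
martingale argument gives convergence of `(k+c)² a_k`. The summability bound makes both limits zero.
-/
lemma smallORates_of_step {a Y : ℕ → Ω → ℝ} {m : ℕ → Ω → Vec p} {c C : ℝ} (hc : 0 < c)
    (hcr : c ≤ r + 2) (ha : ∀ k ω, 0 ≤ a k ω) (hai : ∀ k, Integrable (a k) P)
    (hm : ∀ k, StronglyMeasurable[ℱ k] (m k)) (hm2 : ∀ k, MemLp (m k) 2 P)
    (hY : ∀ k ω, 0 ≤ Y k ω) (hYi : ∀ k, Integrable (Y k) P)
    (hYs : Summable fun k => ∫ ω, Y k ω ∂P)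
    (hstep : ∀ (k : ℕ) ω, ((k + 1 : ℕ) + c) ^ 2 * a (k + 1) ω
      ≤ (k + c) ^ 2 * a k ω + Y k ω - inner ℝ (err H r x S k ω) (m k ω))
    (hsum : SumBound P r C fun k => a (k + 1)) : SmallORates P fun k => a (k + 1) := by
  constructor
  · refine tendsto_sq_mul_succ (a := fun k => ∫ ω, a k ω ∂P) hc hcr
      (fun k => integral_nonneg (ha k)) ?_ hsum.summable
    refine exists_tendsto_of_le_add (fun k => mul_nonneg (sq_nonneg _) (integral_nonneg (ha k)))
      hYs.hasSum.tendsto_sum_nat fun k => ?_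
    have i1 := (hai k).const_mul ((k + c) ^ 2)
    have key := h.integral_le_of_step k (hm k) (hm2 k) (i1.add (hYi k))
      ((hai (k + 1)).const_mul (((k + 1 : ℕ) + c) ^ 2)) (hstep k)
    simp only [Pi.add_apply] at key
    rwa [integral_add i1 (hYi k), integral_const_mul, integral_const_mul] at key
  · have hconv := ae_exists_tendsto_of_le_add (X := fun (k : ℕ) ω => ((k : ℝ) + c) ^ 2 * a k ω)
      h.stronglyMeasurable_err h.memLp_err hm hm2 h.condExp_err
      (fun k ω => mul_nonneg (sq_nonneg _) (ha k ω)) ((hai 0).const_mul _) hY hYi hYs hstep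
    filter_upwards [hconv, hsum.ae_summable h.r_pos.le fun k ω => ha (k + 1) ω] with ω h1 h2
    exact tendsto_sq_mul_succ hc hcr (ha · ω) h1 h2

/-- The shift `c = r + 1` turns the coefficient `(k+r+2)²` of the new increment into `(k+1+c)²`. -/
theorem smallORates_inc : SmallORates P fun k ω => ‖inc x (k + 1) ω‖ ^ 2 := by
  obtain ⟨xs, hxs⟩ := h.exists_zero
  have hr := h.r_pos
  have hs := (h.residualBounds hxs).sum_bound.summable
  refine h.smallORates_of_step (a := fun k ω => ‖inc x k ω‖ ^ 2) (c := r + 1)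
    (Y := fun k ω => β ^ 2 * r * (2 * k + 4 * r) * ‖avg H (x k ω)‖ ^ 2 + errSq H r β x S k ω)
    (by linarith) (by linarith) (fun k ω => sq_nonneg _) h.integrable_inc
    (fun k => (h.stronglyMeasurable_dft k).const_smul (4 * β * (k + r)))
    (fun k => (h.memLp_dft k).const_smul (4 * β * (k + r)))
    (fun k ω => add_nonneg (by positivity) (errSq_nonneg k ω))
    (fun k => ((h.integrable_avg k).const_mul _).add (h.integrable_errSq k)) ?_ (fun k ω => ?_)
    (h.incrementBounds hxs).sum_bound
  · have e : ∀ k : ℕ, ∫ ω, (β ^ 2 * r * (2 * k + 4 * r) * ‖avg H (x k ω)‖ ^ 2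
        + errSq H r β x S k ω) ∂P = β ^ 2 * r * (2 * k + 4 * r) * ∫ ω, ‖avg H (x k ω)‖ ^ 2 ∂P
          + ∫ ω, errSq H r β x S k ω ∂P := fun k => by
      rw [integral_add ((h.integrable_avg k).const_mul _) (h.integrable_errSq k),
        integral_const_mul]
    simp_rw [e]
    refine Summable.add (Summable.of_nonneg_of_le (fun k => ?_) (fun k => ?_)
      (hs.mul_left (4 * (β ^ 2 * r)))) h.summable_integral_errSq
    · exact mul_nonneg (by positivity) (integral_nonneg fun ω => sq_nonneg _)
    · rw [← mul_assoc]
      refine mul_le_mul_of_nonneg_right ?_ (integral_nonneg fun ω => sq_nonneg _)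
      have : 0 ≤ β ^ 2 * r := by positivity
      nlinarith [k.cast_nonneg (α := ℝ)]
  · have h1 := h.inc_step k ω
    have h2 : (k : ℝ) * (k + 2 * r) * ‖inc x k ω‖ ^ 2 ≤ (k + (r + 1)) ^ 2 * ‖inc x k ω‖ ^ 2 :=
      mul_le_mul_of_nonneg_right (by nlinarith [k.cast_nonneg (α := ℝ)]) (sq_nonneg _)
    have e : (((k + 1 : ℕ) : ℝ) + (r + 1)) ^ 2 = (k + r + 2) ^ 2 := by push_cast; ring
    rw [e, Pi.smul_apply]
    linarith

/-- Here `c = r - 1`, and `k(k+r) ≤ (k+r-1)²` holds because `r > 2`. -/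
theorem smallORates_vel : SmallORates P fun k ω => ‖vel H β x (k + 1) ω‖ ^ 2 := by
  obtain ⟨xs, hxs⟩ := h.exists_zero
  have hr := h.two_lt
  have hs := (h.incrementBounds hxs).sum_bound.summable
  refine h.smallORates_of_step (a := fun k ω => ‖vel H β x k ω‖ ^ 2) (c := r - 1)
    (Y := fun k ω => 4 * (k + r) / r * ‖inc x (k + 1) ω‖ ^ 2 + errSq H r β x S k ω)
    (by linarith) (by linarith) (fun k ω => sq_nonneg _) h.integrable_vel
    h.stronglyMeasurable_velocityDir h.memLp_velocityDir
    (fun k ω => add_nonneg (by positivity) (errSq_nonneg k ω))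
    (fun k => ((h.integrable_inc (k + 1)).const_mul _).add (h.integrable_errSq k)) ?_ (fun k ω => ?_)
    (SumBound.of_partial h.r_pos.le (fun k ω => sq_nonneg _) (fun k => h.integrable_vel (k + 1))
      fun N => (h.vel_bounds hxs N).2)
  · have e : ∀ k : ℕ, ∫ ω, (4 * (k + r) / r * ‖inc x (k + 1) ω‖ ^ 2
        + errSq H r β x S k ω) ∂P = 4 * (k + r) / r * ∫ ω, ‖inc x (k + 1) ω‖ ^ 2 ∂P
          + ∫ ω, errSq H r β x S k ω ∂P := fun k => by
      rw [integral_add ((h.integrable_inc (k + 1)).const_mul _) (h.integrable_errSq k),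
        integral_const_mul]
    simp_rw [e]
    refine Summable.add (Summable.of_nonneg_of_le (fun k => ?_) (fun k => ?_)
      (hs.mul_left (4 / r))) h.summable_integral_errSq
    · exact mul_nonneg (by positivity) (integral_nonneg fun ω => sq_nonneg _)
    · rw [← mul_assoc, mul_div_right_comm]
      refine mul_le_mul_of_nonneg_right (mul_le_mul_of_nonneg_left ?_ (by positivity))
        (integral_nonneg fun ω => sq_nonneg _)
      linarith [k.cast_nonneg (α := ℝ)]
  · have h1 := h.vel_step k ω
    have h2 : (k : ℝ) * (k + r) * ‖vel H β x k ω‖ ^ 2 ≤ (k + (r - 1)) ^ 2 * ‖vel H β x k ω‖ ^ 2 :=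
      mul_le_mul_of_nonneg_right (by nlinarith [k.cast_nonneg (α := ℝ)]) (sq_nonneg _)
    have e : (((k + 1 : ℕ) : ℝ) + (r - 1)) ^ 2 = (k + r) ^ 2 := by push_cast; ring
    rw [e]
    linarith

theorem smallORates_avg : SmallORates P fun k ω => ‖avg H (x k ω)‖ ^ 2 := by
  have hβ := h.beta_pos
  have hv := h.smallORates_vel
  have hd := h.smallORates_inc
  have hle : ∀ {k c v d : ℝ}, 4 * β ^ 2 * c ≤ 2 * v + 2 * d →
      k ^ 2 * c ≤ 1 / (2 * β ^ 2) * (k ^ 2 * v + k ^ 2 * d) := by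
    intro k c v d hcvd
    rw [← mul_add, mul_left_comm]
    refine mul_le_mul_of_nonneg_left ?_ (sq_nonneg _)
    rw [one_div_mul_eq_div, le_div_iff₀ (by positivity)]
    linarith
  constructor
  · refine squeeze_zero (fun k => mul_nonneg (sq_nonneg _) (integral_nonneg fun ω => sq_nonneg _))
      (fun k => hle (h.integral_avg_le k)) ?_
    have := (hv.expectation.add hd.expectation).const_mul (1 / (2 * β ^ 2))
    rwa [add_zero, mul_zero] at this
  · filter_upwards [hv.almost_sure, hd.almost_sure] with ω h1 h2
    refine squeeze_zero (fun k => by positivity) (fun k => hle (norm_avg_sq_le_vel k ω)) ?_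
    have := (h1.add h2).const_mul (1 / (2 * β ^ 2))
    rwa [add_zero, mul_zero] at this

lemma ae_exists_tendsto_norm (hxs : avg H xs = 0) :
    ∀ᵐ ω ∂P, ∃ l, Tendsto (fun k => ‖x k ω - xs‖) atTop (𝓝 l) := by
  have hr := h.r_pos
  have hβ := h.beta_pos
  have hconv := ae_exists_tendsto_of_le_add (X := en H r β xs x) (Y := errSq H r β x S)
    h.stronglyMeasurable_err h.memLp_err (h.stronglyMeasurable_enDir (xs := xs)) h.memLp_enDir
    h.condExp_err (fun k ω => (h.en_nonneg hxs k ω).2) (h.integrable_en 0) errSq_nonneg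
    h.integrable_errSq h.summable_integral_errSq fun k ω => by
      have h1 := h.en_step hxs k ω
      have h2 : 0 ≤ (2 * k + r + 3) * ‖inc x (k + 1) ω‖ ^ 2 := by positivity
      have h3 : 0 ≤ 4 * β * k * (k + r) * (1 / L - β) * variation H x k ω :=
        mul_nonneg (mul_nonneg (by positivity) (sub_nonneg.2 h.beta_le)) (variation_nonneg k ω)
      linarith
  filter_upwards [hconv, h.smallORates_inc.almost_sure, h.smallORates_avg.almost_sure]
    with ω ⟨l, hl⟩ h1 h2
  refine tendsto_norm_of_tendsto_energy hr hβ.le hl (fun k => (h.en_nonneg hxs k ω).1)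
    (tendsto_sq_mul_of_succ (fun k => sq_nonneg _) h1)
    -- The energy at index `k` involves the residual at `x^{k-1}`, hence the shift.
    (tendsto_sq_mul_of_succ (a := fun k => ‖avg H (x (k - 1) ω)‖ ^ 2) (fun k => sq_nonneg _) h2)

/-- The exceptional null set in `ae_exists_tendsto_norm` depends on the zero, so only countably many
zeros can be treated at once; a countable dense subset is enough for Opial's argument. -/
lemma ae_exists_tendsto : ∀ᵐ ω ∂P, ∃ z, avg H z = 0 ∧ Tendsto (fun k => x k ω) atTop (𝓝 z) := by
  obtain ⟨D, hDsub, hDc, hD⟩ :=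
    (TopologicalSpace.IsSeparable.of_separableSpace {z | avg H z = 0}).exists_countable_dense_subset
  have hne : D.Nonempty := by
    obtain ⟨xs, hxs⟩ := h.exists_zero
    exact closure_nonempty_iff.1 ⟨xs, hD hxs⟩
  have hall := (ae_ball_iff hDc).2 fun z hz => h.ae_exists_tendsto_norm (hDsub hz)
  filter_upwards [hall, h.smallORates_avg.almost_sure] with ω h1 h2
  refine exists_tendsto_zero_of_dense h.continuous_avg hne hD h1 ?_
  have h3 := h2.sqrt
  rw [Real.sqrt_zero] at h3
  refine squeeze_zero_norm' ?_ h3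
  filter_upwards [eventually_ge_atTop 1] with k hk
  have hk1 : (1 : ℝ) ≤ k := by exact_mod_cast hk
  rw [← mul_pow, Real.sqrt_sq (by positivity)]
  exact le_mul_of_one_le_left (norm_nonneg _) hk1

/-- Almost sure convergence of the iterates to a random zero. -/
theorem exists_limit : ∃ z : Ω → Vec p, Measurable z ∧ (∀ ω, avg H (z ω) = 0) ∧
    ∀ᵐ ω ∂P, Tendsto (fun k => x k ω) atTop (𝓝 (z ω)) := by
  classical
  obtain ⟨xs, hxs⟩ := h.exists_zero
  have hconv := h.ae_exists_tendsto
  obtain ⟨z, hz, hlim⟩ := measurable_limit_of_tendsto_metrizable_ae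
    (fun k => ((h.stronglyMeasurable_x k).mono (ℱ.le k)).measurable.aemeasurable)
    (hconv.mono fun ω ⟨z, _, hz⟩ => ⟨z, hz⟩)
  -- On the null set where the measurable limit may fail to be a zero, a fixed zero replaces it.
  refine ⟨fun ω => if avg H (z ω) = 0 then z ω else xs, ?_, fun ω => ?_, ?_⟩
  · exact Measurable.ite (measurableSet_eq_fun (h.continuous_avg.measurable.comp hz)
      measurable_const) hz measurable_const
  · by_cases hω : avg H (z ω) = 0 <;> simp [hω, hxs]
  · filter_upwards [hconv, hlim] with ω ⟨w, hw, hxw⟩ hxz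
    have e := tendsto_nhds_unique hxz hxw
    rw [if_pos (e ▸ hw)]
    exact hxz

end IsFastKM

/-! ### The backward-forward splitting method as a Krasnoselskii–Mann method -/

section Splitting

variable {n p : ℕ} {G : Fin n → Vec p → Vec p} {T : Vec p → Set (Vec p)} {lam r β : ℝ}
  {Ω : Type*} {x0 : Vec p} {x u Su : ℕ → Ω → Vec p}

/-- As `γ_0 = 0`, the terms of index `-1` disappear and the initial direction is exact. -/
lemma IsVFBFS.direction_zero (hn : 0 < n)
    (h : IsVFBFS G T lam (thetaSeq r) (gammaSeq r) (etaSeq r β) x0 x u Su) (ω : Ω) :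
    direction lam (gammaSeq r) x u Su 0 ω = target (bfsComp G T lam) (gammaSeq r) x 0 ω := by
  have e : avg (bfsComp G T lam) (x 0 ω) = avg G (u 0 ω) + (1 / lam) • (x 0 ω - u 0 ω) := by
    rw [h.u_eq]
    exact bfs_eq hn (x 0 ω)
  simp only [direction, h.Su_zero, target, gammaSeq, Nat.cast_zero, zero_div, zero_smul, sub_zero,
    zero_add, e]

end Splitting

end VFKM

theorem mainTheorem10 {n p : ℕ} (hn : 0 < n)
    -- the inclusion `0 ∈ G u + T u`
    (G : Fin n → Vec p → Vec p) (T : Vec p → Set (Vec p)) (Lg ν : ℝ)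
    (hLg : 0 < Lg) (hν : 0 ≤ ν) (hLgν : Lg * ν < 1)
    (hG : ∀ i, IsCocoercive Lg (G i))
    (hT : IsMaximallyCohypomonotone ν T)
    (hzer : (zerSum (avg G) T).Nonempty)
    -- the parameters
    (lam : ℝ) (hlam : 0 < lam) (hlam_lower : 2 * ν ≤ lam)
    (hlam_upper : lam < 2 * (1 + Real.sqrt (1 - Lg * ν)) / Lg)
    (L : ℝ) (hL : L = bfsL Lg ν lam)
    (r β ρ Θ Θhat : ℝ) (hr : 2 < r) (hρ : ρ < 1)
    (hβ : 0 < β) (hβ_upper : β < betaBar L r ρ (Θ + Θhat))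
    -- the stochastic process
    {Ω : Type*} {mΩ : MeasurableSpace Ω} (P : Measure Ω) [IsProbabilityMeasure P]
    (ℱ : Filtration ℕ mΩ) (x0 : Vec p) (x u Su : ℕ → Ω → Vec p) (Δ : ℕ → Ω → ℝ)
    (hmethod : IsVFBFS G T lam (thetaSeq r) (gammaSeq r) (etaSeq r β) x0 x u Su)
    (hest : IsVREstimator P ℱ (bfsComp G T lam) (gammaSeq r) x
      (direction lam (gammaSeq r) x u Su) ρ Θ Θhat Δ)
    (hΔ0 : ∀ᵐ ω ∂P, Δ 0 ω = 0) :
    -- the resolvent is well defined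
    (∀ y, opResolventSet T lam y = {opResolvent T lam y}) ∧
    -- summability bounds, big-O rates and iteration complexity
    (∀ xs, bfs G T lam xs = 0 →
      IncrementBounds P L r β ρ (Θ + Θhat) (‖x0 - xs‖ ^ 2)
        (fun k ω => ‖x (k + 1) ω - x k ω‖ ^ 2) ∧
      IncrementBounds P L r β ρ (Θ + Θhat) (‖x0 - xs‖ ^ 2)
        (fun k ω => ‖u (k + 1) ω - u k ω‖ ^ 2) ∧
      ResidualBounds P L r β ρ (Θ + Θhat) (‖x0 - xs‖ ^ 2)
        (fun k ω => ‖bfs G T lam (x k ω)‖ ^ 2) ∧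
      ResidualBounds P L r β ρ (Θ + Θhat) (‖x0 - xs‖ ^ 2)
        (fun k ω => ‖fbsResidual G T lam (u k ω)‖ ^ 2)) ∧
    -- small-o rates, in expectation and almost surely
    SmallORates P (fun k ω => ‖x (k + 1) ω - x k ω‖ ^ 2) ∧
    SmallORates P (fun k ω => ‖u (k + 1) ω - u k ω‖ ^ 2) ∧
    SmallORates P (fun k ω => ‖bfs G T lam (x k ω)‖ ^ 2) ∧
    SmallORates P (fun k ω => ‖fbsResidual G T lam (u k ω)‖ ^ 2) ∧
    -- almost sure convergence of the iterates to solutions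
    (∃ xs : Ω → Vec p, Measurable xs ∧ (∀ ω, bfs G T lam (xs ω) = 0) ∧
      (∀ ω, opResolvent T lam (xs ω) ∈ zerSum (avg G) T) ∧
      ∀ᵐ ω ∂P, Tendsto (fun k => x k ω) atTop (𝓝 (xs ω)) ∧
        Tendsto (fun k => u k ω) atTop (𝓝 (opResolvent T lam (xs ω)))) := by
  -- Only the operators `bfsComp` and their estimator `direction` remain visible from here on.
  have hkm : IsFastKM P ℱ (bfsComp G T lam) L r β ρ Θ Θhat x0 x
      (direction lam (gammaSeq r) x u Su) Δ :=
    { n_pos := hn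
      L_pos := hL ▸ bfsL_pos hν hlam hlam_lower hLg hLgν hlam_upper
      cocoercive := hL ▸ bfsComp_cocoercive hT hν hlam hlam_lower hLg hLgν hlam_upper hG
      two_lt := hr
      beta_pos := hβ
      beta_lt := hβ_upper
      init := hmethod.init
      S_zero := hmethod.direction_zero hn
      step := hmethod.step
      est := hest
      Delta_zero := hΔ0
      exists_zero := exists_bfs_eq_zero hT hν hlam hlam_lower hn hzer }
  have hr0 : 0 ≤ r := by linarith
  have hJ := continuous_opResolvent hT hν hlam hlam_lower
  have hu : ∀ k, u k = fun ω => opResolvent T lam (x k ω) := fun k => funext (hmethod.u_eq k)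
  have hxm : ∀ k, AEStronglyMeasurable (x k) P := fun k => (hkm.memLp_x k).1
  have hum : ∀ k, AEStronglyMeasurable (u k) P := fun k => by
    rw [hu]
    exact hJ.comp_aestronglyMeasurable (hxm k)
  -- The statements on `u` and on `fbsResidual` come by pointwise domination, from nonexpansiveness
  -- of the resolvent.
  have hule : ∀ k ω, ‖u (k + 1) ω - u k ω‖ ≤ ‖x (k + 1) ω - x k ω‖ := fun k ω => by
    rw [hu, hu]
    exact norm_opResolvent_sub_le hT hν hlam hlam_lower _ _
  have hule2 : ∀ k ω, ‖u (k + 1) ω - u k ω‖ ^ 2 ≤ ‖x (k + 1) ω - x k ω‖ ^ 2 := fun k ω =>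
    pow_le_pow_left₀ (norm_nonneg _) (hule k ω) 2
  have hui : ∀ k, Integrable (fun ω => ‖u (k + 1) ω - u k ω‖ ^ 2) P := fun k =>
    integrable_norm_sq ((hkm.memLp_inc (k + 1)).of_le ((hum (k + 1)).sub (hum k))
      (ae_of_all _ (hule k)))
  have hFle : ∀ k ω, ‖fbsResidual G T lam (u k ω)‖ ≤ ‖bfs G T lam (x k ω)‖ := fun k ω => by
    rw [hu]
    exact norm_fbsResidual_le hT hν hlam hlam_lower hn _
  have hFle2 : ∀ k ω, ‖fbsResidual G T lam (u k ω)‖ ^ 2 ≤ ‖bfs G T lam (x k ω)‖ ^ 2 := fun k ω =>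
    pow_le_pow_left₀ (norm_nonneg _) (hFle k ω) 2
  have hGc : Continuous (avg G) :=
    (LipschitzWith.of_dist_le_mul (K := Lg.toNNReal) fun y z => by
      simpa [dist_eq_norm, hLg.le] using (avg_cocoercive hG hn hLg).norm_sub_le hLg y z).continuous
  have hFc : Continuous (fbsResidual G T lam) := by
    unfold fbsResidual
    fun_prop
  have hFi : ∀ k, Integrable (fun ω => ‖fbsResidual G T lam (u k ω)‖ ^ 2) P := fun k =>
    integrable_norm_sq ((hkm.memLp_avg k).of_le (hFc.comp_aestronglyMeasurable (hum k))
      (ae_of_all _ (hFle k)))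
  have hxi : ∀ k, Integrable (fun ω => ‖x (k + 1) ω - x k ω‖ ^ 2) P := fun k =>
    hkm.integrable_inc (k + 1)
  have hbi : ∀ k, Integrable (fun ω => ‖bfs G T lam (x k ω)‖ ^ 2) P := hkm.integrable_avg
  refine ⟨opResolventSet_eq_singleton hT hν hlam hlam_lower, fun xs hxs =>
    ⟨hkm.incrementBounds hxs, (hkm.incrementBounds hxs).mono hr0 hui (fun k ω => sq_nonneg _) hule2,
      hkm.residualBounds hxs, (hkm.residualBounds hxs).mono hr0 hFi (fun k ω => sq_nonneg _) hFle2⟩,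
    hkm.smallORates_inc, hkm.smallORates_inc.mono hxi hui (fun k ω => sq_nonneg _) hule2,
    hkm.smallORates_avg, hkm.smallORates_avg.mono hbi hFi (fun k ω => sq_nonneg _) hFle2, ?_⟩
  obtain ⟨z, hzm, hz0, hz⟩ := hkm.exists_limit
  refine ⟨z, hzm, hz0, fun ω => opResolvent_mem_zerSum hT hν hlam hlam_lower hn (hz0 ω), ?_⟩
  filter_upwards [hz] with ω hω
  refine ⟨hω, ?_⟩
  simp_rw [hu]
  exact (hJ.tendsto _).comp hω
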